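/- Let $c,c_1>0$. There is a constant $C>0$, depending only on $c$ and $c_1$, with the following property. Let $\alpha>0$ and let $f:[0,1]^2\to\mathbb{R}$ be $(c,\alpha)$-mixed Hölder, that is, for all $x,x',y,y'\in[0,1]$, $$|f(x',y)-f(x,y)|\le c|x'-x|^\alpha,\qquad |f(x,y')-f(x,y)|\le c|y'-y|^\alpha,$$ $$|f(x',y')-f(x,y')-f(x',y)+f(x,y)|\le c\,(|x'-x|\,|y'-y|)^\alpha.$$ Let $n\ge 1$ and $l$ be integers with $l\ge c_1 n\log^2 n$ (natural logarithm), and let $X_1,\dots,X_l$ be independent random points, uniformly distributed on $[0,1]^2$. Then, with probability at least $1-n^{2-c_1}$, the approximation $\tilde f$ computed as described below from $n$, $c_1$, the locations $X_1,\dots,X_l$ and the values $f(X_1),\dots,f(X_l)$ alone satisfies $$\|f-\tilde f\|_{L^2([0,1]^2)}\le C\,n^{-\alpha}\log^{3/2}n .$$ Construction of $\tilde f$ (for $n\ge2$, so that $l\ge1$; for $n=1$ the probability bound is trivial). Put $m=\lfloor\log_2 n\rfloor$. Dyadic intervals are the intervals $[j2^{-k},(j+1)2^{-k})$ with $k\ge0$,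 $0\le j<2^k$, and dyadic rectangles are products of two of them. Let $R_1,\dots,R_{2^m}$ be the dyadic rectangles of width $1$ and height $2^{-m}$, and let $T_1,\dots,T_{m2^{m-1}}$ be the dyadic rectangles of area $2^{-m+1}$, with left and right halves $T_j^+$ and $T_j^-$. Define $\Psi:[0,1]^2\to\mathbb{R}^{(m+2)2^{m-1}}$ by $\Psi_j=\chi_{R_j}$ for $1\le j\le 2^m$ and $\Psi_{2^m+j}=\frac{1}{\sqrt2}(\chi_{T_j^+}-\chi_{T_j^-})$ for $1\le j\le m2^{m-1}$. Starting from $v_0=0$, perform the Kaczmarz steps $$v_k=v_{k-1}+\frac{f(X_k)-f(X_1)-\langle\Psi(X_k),v_{k-1}\rangle}{1+m/2}\,\Psi(X_k),\qquad k=1,\dots,L,\quad L=\lceil c_1n\log^2n\rceil,$$ and set $\tilde f(x)=f(X_1)+\langle\Psi(x),v_L\rangle$. -/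

import Mathlib

open MeasureTheory ProbabilityTheory unitInterval

noncomputable section

/-- A function `f` on the unit square is `(c, α)`-mixed Hölder. -/
def IsMixedHolder (c α : ℝ) (f : I × I → ℝ) : Prop :=
  (∀ x x' y : I, |f (x', y) - f (x, y)| ≤ c * |(x' : ℝ) - x| ^ α) ∧
  (∀ x y y' : I, |f (x, y') - f (x, y)| ≤ c * |(y' : ℝ) - y| ^ α) ∧
  (∀ x x' y y' : I, |f (x', y') - f (x, y') - f (x', y) + f (x, y)|
    ≤ c * (|(x' : ℝ) - x| * |(y' : ℝ) - y|) ^ α)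

/-- The half-open dyadic interval `[j 2⁻ᵏ, (j + 1) 2⁻ᵏ)`, with `j` counted from `0`. -/
def dyadicInterval (k j : ℕ) : Set ℝ :=
  Set.Ico ((j : ℝ) / 2 ^ k) (((j : ℝ) + 1) / 2 ^ k)

/-- The dyadic rectangle of width `2⁻ᵃ` in column `i` and of height `2⁻ᵇ` in row `j`. -/
def dyadicRectangle (a i b j : ℕ) : Set (I × I) :=
  {p | (p.1 : ℝ) ∈ dyadicInterval a i ∧ (p.2 : ℝ) ∈ dyadicInterval b j}

/-- The coordinates of the embedding: `Sum.inl j` stands for the dyadic rectangle of width `1`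
and height `2⁻ᵐ` in row `j`; `Sum.inr ⟨k, i, j⟩` stands for the dyadic rectangle of width `2⁻ᵏ`
and height `2^(k - m + 1)` (hence of area `2^(- m + 1)`) in column `i` and row `j`. For `m ≥ 1`
there are `(m + 2) 2^(m - 1)` of them. -/
abbrev EmbIndex (m : ℕ) : Type :=
  Fin (2 ^ m) ⊕ (Σ k : Fin m, Fin (2 ^ (k : ℕ)) × Fin (2 ^ (m - 1 - (k : ℕ))))

/-- The dyadic-rectangle embedding `Ψ` of the unit square: indicator functions of the rectangles
of width `1` and height `2⁻ᵐ`, and, for every dyadic rectangle of area `2^(- m + 1)`,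
`1 / √2` times the indicator of its left half minus the indicator of its right half. -/
def embed (m : ℕ) (p : I × I) : EmbIndex m → ℝ
  | Sum.inl j => (dyadicRectangle 0 0 m j).indicator 1 p
  | Sum.inr ⟨k, i, j⟩ => 1 / √2 *
      ((dyadicRectangle (k + 1) (2 * i) (m - 1 - k) j).indicator 1 p
        - (dyadicRectangle (k + 1) (2 * i + 1) (m - 1 - k) j).indicator 1 p)

/-- The Kaczmarz iterates for the equations `⟨Ψ(x_k), v⟩ = b_k`, started at the zero vector; the
`k`-th step uses the `k`-th sample, and nothing changes once the samples are used up. For all `x`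
with both coordinates less than `1`, the squared Euclidean norm of `Ψ(x)` is `1 + m / 2`. -/
def kaczmarz (m : ℕ) {l : ℕ} (x : Fin l → I × I) (b : Fin l → ℝ) : ℕ → EmbIndex m → ℝ
  | 0 => 0
  | k + 1 =>
      if h : k < l then
        kaczmarz m x b k
          + ((b ⟨k, h⟩ - embed m (x ⟨k, h⟩) ⬝ᵥ kaczmarz m x b k) / (1 + (m : ℝ) / 2))
            • embed m (x ⟨k, h⟩)
      else kaczmarz m x b k

/-- The first entry of a tuple (and `0` for the empty tuple). -/
def firstValue {l : ℕ} (y : Fin l → ℝ) : ℝ :=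
  if h : 0 < l then y ⟨0, h⟩ else 0

/-- The approximation computed from the sample locations `x` and the sample values `y`: with
`m = ⌊log₂ n⌋`, subtract the first value from all the values, perform
`⌈c₁ n log² n⌉` Kaczmarz steps from the zero vector to get a vector `v`, and return
`p ↦ y₁ + ⟨Ψ(p), v⟩`. -/
def kaczmarzApprox (c₁ : ℝ) (n : ℕ) {l : ℕ} (x : Fin l → I × I) (y : Fin l → ℝ) (p : I × I) : ℝ :=
  firstValue y + embed (Nat.log 2 n) p ⬝ᵥ
    kaczmarz (Nat.log 2 n) x (fun k => y k - firstValue y) ⌈c₁ * n * Real.log n ^ 2⌉₊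

end

/-! The coordinates of `Ψ` are orthogonal in L², each of squared norm 2⁻ᵐ, so `‖⟨Ψ, w⟩‖²` in L² is
2⁻ᵐ|w|² (`integral_sq_embed_dotProduct`), while |Ψ(p)|² = 1 + m/2 for almost every p. Their span
contains the indicators of all dyadic rectangles of area 2⁻ᵐ (`rectInd_mem_embedRange`), hence the
sparse-grid interpolant of `f`, which is uniformly within ε = O(m (2·2⁻ᵐ)^α) of `f`
(`abs_sub_sparseGrid_le`).

A Kaczmarz step is linear in the data, and the data split as f(X_k) - f(X₁) = ⟨Ψ(X_k), z⟩ -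
t⟨Ψ(X_k), u⟩ + e_k, where z represents the interpolant of f - f(0,0), u represents 1, t = f(X₁) -
f(0,0) and |e_k| ≤ ε. Only the scalar t and the residuals are random besides the samples; z and u
are deterministic. For the two consistent systems a step projects the error orthogonally to Ψ(X_k),
which multiplies its expected square by 1 - 2⁻ᵐ/(1 + m/2) (`lintegral_kaczmarzError`); L steps give
a factor n^(-c₁), and Markov's inequality costs probability n^(2-c₁)/2 for each system
(`measure_kaczmarzError_gt_le`).

The residuals contribute at most Lε²/(1 + m/2) to the squared norm (`kaczmarz_dotProduct_self_le`).
As 2⁻ᵐL is of order log² n and ε²/(1 + m/2) of order n^(-2α) log n, this is the source of log^(3/2)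
n. The argument needs α ≤ 1; for α > 1 the function is constant and is recovered exactly. -/

noncomputable section

/-! ### Dyadic indicators and Haar functions of one variable. -/

/-- The indicator function of a dyadic interval. -/
def dyadicInd (k i : ℕ) (x : ℝ) : ℝ := (dyadicInterval k i).indicator 1 x

/-- The Haar function of a dyadic interval, with values `1` and `-1` on the two halves. -/
def haarFun (k i : ℕ) (x : ℝ) : ℝ := dyadicInd (k + 1) (2 * i) x - dyadicInd (k + 1) (2 * i + 1) x

theorem mem_dyadicInterval_iff {x : ℝ} (hx : 0 ≤ x) (k i : ℕ) :
    x ∈ dyadicInterval k i ↔ ⌊x * 2 ^ k⌋₊ = i := by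
  have h2 : (0 : ℝ) < 2 ^ k := by positivity
  rw [Nat.floor_eq_iff (by positivity), dyadicInterval, Set.mem_Ico, div_le_iff₀ h2, lt_div_iff₀ h2]

theorem dyadicInd_eq_ite {x : ℝ} (hx : 0 ≤ x) (k i : ℕ) :
    dyadicInd k i x = if ⌊x * 2 ^ k⌋₊ = i then 1 else 0 := by
  classical
  simp [dyadicInd, Set.indicator_apply, mem_dyadicInterval_iff hx]

theorem floor_mul_two_pow_add (x : ℝ) (k d : ℕ) :
    ⌊x * 2 ^ k⌋₊ = ⌊x * 2 ^ (k + d)⌋₊ / 2 ^ d := by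
  have h := Nat.floor_div_natCast (x * 2 ^ (k + d)) (2 ^ d)
  rw [← h, pow_add]
  congr 1
  push_cast
  field_simp

theorem floor_mul_two_pow_lt {x : ℝ} (hx1 : x < 1) (k : ℕ) :
    ⌊x * 2 ^ k⌋₊ < 2 ^ k := by
  have h2 : (0 : ℝ) < 2 ^ k := by positivity
  rw [Nat.floor_lt' (by positivity)]
  push_cast
  nlinarith

theorem dyadicInd_split {x : ℝ} (hx : 0 ≤ x) (k i : ℕ) :
    dyadicInd k i x = dyadicInd (k + 1) (2 * i) x + dyadicInd (k + 1) (2 * i + 1) x := by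
  have h := floor_mul_two_pow_add x k 1
  simp only [dyadicInd_eq_ite hx]
  generalize ⌊x * 2 ^ (k + 1)⌋₊ = a at *
  rw [h]
  split_ifs <;> first | omega | norm_num

theorem sum_dyadicInd_mul {x : ℝ} (hx : 0 ≤ x) (hx1 : x < 1) (k : ℕ) (a : ℕ → ℝ) :
    ∑ i : Fin (2 ^ k), dyadicInd k i x * a i = a ⌊x * 2 ^ k⌋₊ := by
  rw [Fin.sum_univ_eq_sum_range (fun i => dyadicInd k i x * a i)]
  simp only [dyadicInd_eq_ite hx]
  simp [floor_mul_two_pow_lt hx1 k]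

theorem sum_dyadicInd {x : ℝ} (hx : 0 ≤ x) (hx1 : x < 1) (k : ℕ) :
    ∑ i : Fin (2 ^ k), dyadicInd k i x = 1 := by
  simpa using sum_dyadicInd_mul hx hx1 k (fun _ => 1)

theorem dyadicInd_mul_self (k i : ℕ) (x : ℝ) :
    dyadicInd k i x * dyadicInd k i x = dyadicInd k i x := by
  classical
  simp only [dyadicInd, Set.indicator_apply]
  split_ifs <;> simp

theorem dyadicInd_mul_of_ne {x : ℝ} (hx : 0 ≤ x) (k : ℕ) {i j : ℕ} (h : i ≠ j) :
    dyadicInd k i x * dyadicInd k j x = 0 := by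
  simp only [dyadicInd_eq_ite hx]
  split_ifs <;> first | omega | simp

theorem haarFun_mul_self {x : ℝ} (hx : 0 ≤ x) (k i : ℕ) :
    haarFun k i x * haarFun k i x = dyadicInd k i x := by
  simp only [haarFun, dyadicInd_split hx k i, dyadicInd_eq_ite hx]
  split_ifs <;> first | omega | norm_num

theorem haarFun_mul_of_ne {x : ℝ} (hx : 0 ≤ x) (k : ℕ) {i j : ℕ} (h : i ≠ j) :
    haarFun k i x * haarFun k j x = 0 := by
  simp only [haarFun, dyadicInd_eq_ite hx]
  split_ifs <;> first | omega | norm_num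

/-- The finer Haar function is supported in a single interval of level `k + 1`, namely number `j / 2
^ d`, and there the coarser one is constant. Orthogonality of distinct levels follows, since the
finer function has mean zero. -/
theorem haarFun_mul_of_lt {x : ℝ} (hx : 0 ≤ x) (k d i j : ℕ) :
    haarFun k i x * haarFun (k + 1 + d) j x =
      ((if j / 2 ^ d = 2 * i then 1 else 0) - (if j / 2 ^ d = 2 * i + 1 then 1 else 0)) *
        haarFun (k + 1 + d) j x := by
  by_cases hj : ⌊x * 2 ^ (k + 1 + d)⌋₊ = j
  · have h1 := floor_mul_two_pow_add x (k + 1) d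
    rw [hj] at h1
    congr 1
    simp only [haarFun, dyadicInd_eq_ite hx, h1]
  · have h0 := floor_mul_two_pow_add x (k + 1 + d) 1
    have : haarFun (k + 1 + d) j x = 0 := by
      simp only [haarFun, dyadicInd_eq_ite hx]
      generalize ⌊x * 2 ^ (k + 1 + d + 1)⌋₊ = a at *
      rw [if_neg (by omega), if_neg (by omega), sub_zero]
    rw [this, mul_zero, mul_zero]

@[fun_prop]
theorem measurable_dyadicInd (k i : ℕ) : Measurable (dyadicInd k i) :=
  measurable_one.indicator measurableSet_Ico

@[fun_prop]
theorem measurable_haarFun (k i : ℕ) : Measurable (haarFun k i) :=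
  (measurable_dyadicInd _ _).sub (measurable_dyadicInd _ _)

theorem abs_dyadicInd_le (k i : ℕ) (x : ℝ) : |dyadicInd k i x| ≤ 1 := by
  classical
  simp only [dyadicInd, Set.indicator_apply]
  split_ifs <;> simp

theorem integrable_dyadicInd (k i : ℕ) : Integrable (fun x : I => dyadicInd k i x) :=
  Integrable.of_bound
    ((measurable_dyadicInd k i).comp measurable_subtype_coe).aestronglyMeasurable 1
    (.of_forall fun x => abs_dyadicInd_le k i x)

theorem integral_dyadicInd {k i : ℕ} (hi : i < 2 ^ k) :
    ∫ x : I, dyadicInd k i x = ((2 : ℝ) ^ k)⁻¹ := by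
  have h2 : (0 : ℝ) < 2 ^ k := by positivity
  have hi' : (i : ℝ) + 1 ≤ 2 ^ k := by exact_mod_cast hi
  have h : (fun x : I => dyadicInd k i x) =
      (Set.Ico (⟨i / 2 ^ k, by positivity, by rw [div_le_one h2]; linarith⟩ : I)
        ⟨(i + 1) / 2 ^ k, by positivity, by rw [div_le_one h2]; linarith⟩).indicator 1 := by
    ext x
    rfl
  rw [h, integral_indicator_one measurableSet_Ico, Measure.real, unitInterval.volume_Ico,
    ENNReal.toReal_ofReal]
  · simp only
    field_simp
    ring
  · simp only
    rw [sub_nonneg]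
    gcongr
    linarith

theorem integral_haarFun {k i : ℕ} (hi : i < 2 ^ k) : ∫ x : I, haarFun k i x = 0 := by
  simp only [haarFun]
  rw [integral_sub (integrable_dyadicInd _ _) (integrable_dyadicInd _ _),
    integral_dyadicInd (by rw [pow_succ]; omega), integral_dyadicInd (by rw [pow_succ]; omega),
    sub_self]

theorem integral_haarFun_mul_haarFun_of_lt {k k' : ℕ} (h : k < k') (i : ℕ) {j : ℕ}
    (hj : j < 2 ^ k') : ∫ x : I, haarFun k i x * haarFun k' j x = 0 := by
  obtain ⟨d, rfl⟩ := Nat.exists_eq_add_of_le h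
  simp only [fun x : I => haarFun_mul_of_lt x.2.1 k d i j]
  rw [integral_const_mul, integral_haarFun hj, mul_zero]

theorem integral_haarFun_mul_haarFun {k i k' j : ℕ} (hi : i < 2 ^ k) (hj : j < 2 ^ k')
    (h : ¬(k = k' ∧ i = j)) : ∫ x : I, haarFun k i x * haarFun k' j x = 0 := by
  rcases lt_trichotomy k k' with hk | rfl | hk
  · exact integral_haarFun_mul_haarFun_of_lt hk i hj
  · simp [fun x : I => haarFun_mul_of_ne x.2.1 k (i := i) (j := j) (by tauto)]
  · simp_rw [mul_comm (haarFun k i _)]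
    exact integral_haarFun_mul_haarFun_of_lt hk j hi

/-! ### L² orthogonality of the coordinates of the embedding. -/

theorem dyadicRectangle_indicator (a i b j : ℕ) (p : I × I) :
    (dyadicRectangle a i b j).indicator 1 p = dyadicInd a i p.1 * dyadicInd b j p.2 := by
  classical
  simp only [dyadicInd, dyadicRectangle, Set.indicator_apply, Set.mem_ofPred_eq, Pi.one_apply]
  split_ifs <;> simp_all

/-- The factor of a coordinate of the embedding that depends on the first variable. -/
def embedFst (m : ℕ) : EmbIndex m → ℝ → ℝ
  | Sum.inl _ => dyadicInd 0 0
  | Sum.inr ⟨k, i, _⟩ => haarFun k i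

/-- The factor of a coordinate of the embedding that depends on the second variable. -/
def embedSnd (m : ℕ) : EmbIndex m → ℝ → ℝ
  | Sum.inl j => dyadicInd m j
  | Sum.inr ⟨k, _, j⟩ => dyadicInd (m - 1 - k) j

/-- The scale of a coordinate of the embedding. -/
def embedScale (m : ℕ) : EmbIndex m → ℝ
  | Sum.inl _ => 1
  | Sum.inr _ => 1 / √2

theorem embed_eq (m : ℕ) (p : I × I) (a : EmbIndex m) :
    embed m p a = embedScale m a * (embedFst m a p.1 * embedSnd m a p.2) := by
  rcases a with j | ⟨k, i, j⟩
  · simp [embed, embedScale, embedFst, embedSnd, dyadicRectangle_indicator]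
  · simp only [embed, embedScale, embedFst, embedSnd, dyadicRectangle_indicator, haarFun]
    ring

theorem measurable_embed_apply (m : ℕ) (a : EmbIndex m) : Measurable fun p => embed m p a := by
  simp only [embed_eq]
  have h1 : Measurable (embedFst m a) := by
    rcases a with j | ⟨k, i, j⟩ <;> simp only [embedFst] <;> fun_prop
  have h2 : Measurable (embedSnd m a) := by
    rcases a with j | ⟨k, i, j⟩ <;> simp only [embedSnd] <;> fun_prop
  fun_prop

theorem dyadicInd_zero_mul_haarFun {x : ℝ} (hx : 0 ≤ x) {k i : ℕ} (hi : i < 2 ^ k) :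
    dyadicInd 0 0 x * haarFun k i x = haarFun k i x := by
  have h := floor_mul_two_pow_add x 0 (k + 1)
  simp only [haarFun, dyadicInd_eq_ite hx]
  simp only [h, zero_add, Nat.div_eq_zero_iff_lt (show 0 < 2 ^ (k + 1) by positivity)]
  generalize ⌊x * 2 ^ (k + 1)⌋₊ = a at *
  split_ifs <;> first | omega | norm_num

/-- Coordinates are products, so the integral factors. Different Haar functions already kill the
first factor; if the first factors agree, distinct rows are disjoint. The scale 1/√2 gives the large
rectangles the same norm as the rows: (1/2)·2⁻ᵏ·2^(-(m-1-k)) = 2⁻ᵐ. -/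
theorem integral_embed_mul_embed (m : ℕ) (a b : EmbIndex m) :
    ∫ p : I × I, embed m p a * embed m p b = if a = b then ((2 : ℝ) ^ m)⁻¹ else 0 := by
  have key : ∫ p : I × I, embed m p a * embed m p b = (embedScale m a * embedScale m b) *
      ((∫ x : I, embedFst m a x * embedFst m b x) * ∫ y : I, embedSnd m a y * embedSnd m b y) := by
    rw [← integral_prod_mul, ← integral_const_mul]
    refine integral_congr_ae (.of_forall fun p => ?_)
    simp only [embed_eq]
    ring
  rw [key]
  rcases a with j | ⟨k, i, j⟩ <;> rcases b with j' | ⟨k', i', j'⟩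
  · simp only [embedFst, embedSnd, embedScale, dyadicInd_mul_self, Sum.inl.injEq]
    rw [integral_dyadicInd (by norm_num)]
    split_ifs with h
    · subst h
      simp only [dyadicInd_mul_self]
      rw [integral_dyadicInd j.2]
      simp
    · simp [fun x : I => dyadicInd_mul_of_ne x.2.1 m (Fin.val_injective.ne h)]
  · simp only [embedFst, embedSnd, embedScale, reduceCtorEq, if_false,
      fun x : I => dyadicInd_zero_mul_haarFun x.2.1 i'.2]
    rw [integral_haarFun i'.2]
    simp
  · simp only [embedFst, embedSnd, embedScale, reduceCtorEq, if_false,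
      mul_comm (haarFun k i _), fun x : I => dyadicInd_zero_mul_haarFun x.2.1 i.2]
    rw [integral_haarFun i.2]
    simp
  · simp only [embedFst, embedSnd, embedScale]
    by_cases h : (k : ℕ) = k' ∧ (i : ℕ) = i'
    · obtain ⟨h1, h2⟩ := h
      obtain rfl := Fin.ext h1
      obtain rfl := Fin.ext h2
      by_cases hj : j = j'
      · subst hj
        simp only [dyadicInd_mul_self, fun x : I => haarFun_mul_self x.2.1 k i, if_true]
        rw [integral_dyadicInd i.2, integral_dyadicInd j.2]
        have hs : (√2 : ℝ) * √2 = 2 := Real.mul_self_sqrt (by norm_num)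
        have hm : (2 : ℝ) ^ m = 2 * (2 ^ (k : ℕ) * 2 ^ (m - 1 - (k : ℕ))) := by
          rw [← pow_add, ← pow_succ']
          congr 1
          omega
        rw [hm, mul_inv, mul_inv, div_mul_div_comm, hs]
        norm_num
      · rw [if_neg (by simp [hj])]
        simp [fun x : I => dyadicInd_mul_of_ne x.2.1 (m - 1 - k) (Fin.val_injective.ne hj)]
    · rw [integral_haarFun_mul_haarFun i.2 i'.2 h, if_neg, zero_mul, mul_zero]
      rintro ⟨⟩
      simp at h

theorem abs_embed_le (m : ℕ) (p : I × I) (a : EmbIndex m) : |embed m p a| ≤ 2 := by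
  have hs : |1 / √2| ≤ 1 := by
    rw [abs_of_nonneg (by positivity), div_le_one (by positivity)]
    exact Real.one_le_sqrt.2 (by norm_num)
  rcases a with j | ⟨k, i, j⟩
  · simp only [embed, dyadicRectangle_indicator, abs_mul]
    have h1 := abs_dyadicInd_le 0 0 p.1
    have h2 := abs_dyadicInd_le m j p.2
    nlinarith [abs_nonneg (dyadicInd 0 0 p.1), abs_nonneg (dyadicInd m j p.2)]
  · simp only [embed, dyadicRectangle_indicator]
    rw [abs_mul]
    have h (a b : ℕ) (c d : ℕ) : |dyadicInd a b p.1 * dyadicInd c d p.2| ≤ 1 := by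
      rw [abs_mul]
      exact mul_le_one₀ (abs_dyadicInd_le _ _ _) (abs_nonneg _) (abs_dyadicInd_le _ _ _)
    calc _ ≤ 1 * (1 + 1) := mul_le_mul hs ((abs_sub _ _).trans (add_le_add (h _ _ _ _) (h _ _ _ _)))
          (abs_nonneg _) zero_le_one
      _ = 2 := by norm_num

theorem integrable_embed_mul_embed (m : ℕ) (a b : EmbIndex m) :
    Integrable fun p : I × I => embed m p a * embed m p b := by
  refine Integrable.of_bound
    (((measurable_embed_apply m a).mul (measurable_embed_apply m b)).aestronglyMeasurable) (2 * 2)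
    (.of_forall fun p => ?_)
  rw [norm_mul]
  exact mul_le_mul (abs_embed_le _ _ _) (abs_embed_le _ _ _) (abs_nonneg _) zero_le_two

theorem sq_embed_dotProduct (m : ℕ) (p : I × I) (w : EmbIndex m → ℝ) :
    (embed m p ⬝ᵥ w) ^ 2 = ∑ a, ∑ b, w a * w b * (embed m p a * embed m p b) := by
  rw [sq, dotProduct, Finset.sum_mul_sum]
  exact Finset.sum_congr rfl fun a _ => Finset.sum_congr rfl fun b _ => by ring

theorem integrable_sq_embed_dotProduct (m : ℕ) (w : EmbIndex m → ℝ) :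
    Integrable fun p : I × I => (embed m p ⬝ᵥ w) ^ 2 := by
  simp only [sq_embed_dotProduct]
  exact integrable_finsetSum _ fun a _ => integrable_finsetSum _ fun b _ =>
    (integrable_embed_mul_embed m a b).const_mul _

theorem integral_sq_embed_dotProduct (m : ℕ) (w : EmbIndex m → ℝ) :
    ∫ p : I × I, (embed m p ⬝ᵥ w) ^ 2 = ((2 : ℝ) ^ m)⁻¹ * (w ⬝ᵥ w) := by
  simp only [sq_embed_dotProduct]
  rw [integral_finsetSum _ fun a _ => integrable_finsetSum _ fun b _ =>
    (integrable_embed_mul_embed m a b).const_mul _, dotProduct, Finset.mul_sum]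
  refine Finset.sum_congr rfl fun a _ => ?_
  rw [integral_finsetSum _ fun b _ => (integrable_embed_mul_embed m a b).const_mul _]
  simp only [integral_const_mul, integral_embed_mul_embed]
  simp
  ring

/-! ### The norm of the embedding and the functions it represents. -/

/-- The half-open unit square. -/
def openUnitSquare : Set (I × I) := {p | (p.1 : ℝ) < 1 ∧ (p.2 : ℝ) < 1}

/-- The pointwise identities fail where a coordinate equals 1, since 1 lies in no dyadic interval;
this makes the exceptional set negligible. -/
theorem ae_mem_openUnitSquare : ∀ᵐ p : I × I, p ∈ openUnitSquare := by
  have h : ∀ᵐ x : I, x ≠ 1 := by simp [ae_iff]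
  have h1 : ∀ᵐ p : I × I, p.1 ≠ 1 := Measure.quasiMeasurePreserving_fst.ae h
  have h2 : ∀ᵐ p : I × I, p.2 ≠ 1 := Measure.quasiMeasurePreserving_snd.ae h
  filter_upwards [h1, h2] with p hp1 hp2
  exact ⟨unitInterval.lt_one_iff_ne_one.2 hp1, unitInterval.lt_one_iff_ne_one.2 hp2⟩

/-- The rectangles of each shape tile the half-open square, so the rows contribute 1 and each of the
`m` larger shapes contributes 1/2. -/
theorem embed_dotProduct_embed {m : ℕ} {p : I × I} (hp : p ∈ openUnitSquare) :
    embed m p ⬝ᵥ embed m p = 1 + (m : ℝ) / 2 := by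
  have hx := p.1.2.1
  have hy := p.2.2.1
  have hs : (1 / √2 : ℝ) * (1 / √2) = 1 / 2 := by
    rw [div_mul_div_comm, Real.mul_self_sqrt (by norm_num), one_mul]
  have e : ∀ a : EmbIndex m, embed m p a * embed m p a = (embedScale m a * embedScale m a) *
      ((embedFst m a p.1 * embedFst m a p.1) * (embedSnd m a p.2 * embedSnd m a p.2)) := by
    intro a
    rw [embed_eq]
    ring
  simp only [dotProduct, e, Fintype.sum_sum_type, Fintype.sum_sigma, Fintype.sum_prod_type,
    embedScale, embedFst, embedSnd, dyadicInd_mul_self, haarFun_mul_self hx, hs,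
    ← Finset.mul_sum, ← Finset.sum_mul, sum_dyadicInd hx hp.1, sum_dyadicInd hy hp.2]
  have h0 := sum_dyadicInd hx hp.1 0
  simp at h0
  simp [h0]
  ring

/-- The vector representing the constant function `1`. -/
def constVec (m : ℕ) : EmbIndex m → ℝ := Sum.elim 1 0

theorem embed_dotProduct_constVec {m : ℕ} {p : I × I} (hp : p ∈ openUnitSquare) :
    embed m p ⬝ᵥ constVec m = 1 := by
  have h0 := sum_dyadicInd p.1.2.1 hp.1 0
  have h1 := sum_dyadicInd p.2.2.1 hp.2 m
  simp at h0
  simp [dotProduct, constVec, embed, dyadicRectangle_indicator, h0, h1]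

/-- The functions that agree on the half-open unit square with a linear functional of the
embedding. -/
def embedRange (m : ℕ) : Submodule ℝ (I × I → ℝ) where
  carrier := {g | ∃ w, ∀ p ∈ openUnitSquare, g p = embed m p ⬝ᵥ w}
  zero_mem' := ⟨0, by simp⟩
  add_mem' := by
    rintro g g' ⟨w, hw⟩ ⟨w', hw'⟩
    exact ⟨w + w', fun p hp => by simp [hw p hp, hw' p hp, dotProduct_add]⟩
  smul_mem' := by
    rintro r g ⟨w, hw⟩
    exact ⟨r • w, fun p hp => by simp [hw p hp, dotProduct_smul]⟩

theorem embedRange_congr {m : ℕ} {g g' : I × I → ℝ} (hg : g ∈ embedRange m)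
    (h : ∀ p ∈ openUnitSquare, g' p = g p) : g' ∈ embedRange m := by
  obtain ⟨w, hw⟩ := hg
  exact ⟨w, fun p hp => (h p hp).trans (hw p hp)⟩

theorem embed_apply_mem_embedRange (m : ℕ) (a : EmbIndex m) :
    (fun p => embed m p a) ∈ embedRange m := by
  classical
  exact ⟨Pi.single a 1, fun p _ => by simp⟩

/-- The indicator function of a dyadic rectangle, as a product. -/
def rectInd (a i b j : ℕ) (p : I × I) : ℝ := dyadicInd a i p.1 * dyadicInd b j p.2

theorem rectInd_split_snd (a i b j : ℕ) :
    rectInd a i b j = rectInd a i (b + 1) (2 * j) + rectInd a i (b + 1) (2 * j + 1) := by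
  ext p
  simp only [rectInd, Pi.add_apply, dyadicInd_split p.2.2.1 b j]
  ring

/-- Induction on the number of horizontal halvings: the rectangle is half of its parent plus or
minus the parent's Haar coordinate, and the parent, of area 2^(-m+1), is a union of two wider
rectangles of area 2⁻ᵐ. -/
theorem rectInd_mem_embedRange {m k d : ℕ} (h : k + d = m) {i j : ℕ} (hi : i < 2 ^ k)
    (hj : j < 2 ^ d) : rectInd k i d j ∈ embedRange m := by
  induction k generalizing d i j with
  | zero =>
    obtain rfl : d = m := by omega
    obtain rfl : i = 0 := by simpa using hi
    convert embed_apply_mem_embedRange d (Sum.inl ⟨j, hj⟩) using 2 with p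
    simp [rectInd, embed, dyadicRectangle_indicator]
  | succ k ih =>
    have hi2 : i / 2 < 2 ^ k := by rw [pow_succ] at hi; omega
    have hT : rectInd k (i / 2) d j ∈ embedRange m := by
      rw [rectInd_split_snd]
      exact add_mem (ih (by omega) hi2 (by rw [pow_succ]; omega))
        (ih (by omega) hi2 (by rw [pow_succ]; omega))
    have hd : m - 1 - k = d := by omega
    have hH := embed_apply_mem_embedRange m
      (Sum.inr ⟨⟨k, by omega⟩, ⟨i / 2, hi2⟩, ⟨j, by simpa only [hd] using hj⟩⟩)
    have h2 : √2 * (1 / √2) = 1 := by field_simp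
    rcases Nat.even_or_odd' i with ⟨i', rfl | rfl⟩
    · have e : 2 * i' / 2 = i' := by omega
      refine embedRange_congr (((embedRange m).smul_mem (1 / 2)
        (add_mem hT ((embedRange m).smul_mem √2 hH)))) fun p _ => ?_
      simp only [rectInd, embed, dyadicRectangle_indicator, Pi.add_apply, Pi.smul_apply,
        smul_eq_mul, hd, dyadicInd_split p.1.2.1 k, ← mul_assoc, h2, e]
      ring
    · have e : (2 * i' + 1) / 2 = i' := by omega
      refine embedRange_congr (((embedRange m).smul_mem (1 / 2)
        (sub_mem hT ((embedRange m).smul_mem √2 hH)))) fun p _ => ?_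
      simp only [rectInd, embed, dyadicRectangle_indicator, Pi.sub_apply, Pi.smul_apply,
        smul_eq_mul, hd, dyadicInd_split p.1.2.1 k, ← mul_assoc, h2, e]
      ring

/-! ### Sparse-grid approximation of mixed Hölder functions. -/

/-- The left endpoint of the dyadic interval of length `2⁻ᵃ` that contains `x`. -/
def dyadicNode (a : ℕ) (x : I) : I := Set.projIcc 0 1 zero_le_one ((⌊(x : ℝ) * 2 ^ a⌋₊ : ℝ) / 2 ^ a)

theorem coe_dyadicNode (a : ℕ) (x : I) :
    (dyadicNode a x : ℝ) = (⌊(x : ℝ) * 2 ^ a⌋₊ : ℝ) / 2 ^ a := by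
  have h2 : (0 : ℝ) < 2 ^ a := by positivity
  have hx := x.2.1
  have h := Nat.floor_le (a := (x : ℝ) * 2 ^ a) (by positivity)
  rw [dyadicNode, Set.projIcc_of_mem zero_le_one ⟨by positivity, ?_⟩]
  rw [div_le_one h2]
  nlinarith [x.2.2]

theorem dyadicNode_le (a : ℕ) (x : I) : (dyadicNode a x : ℝ) ≤ x := by
  have h2 : (0 : ℝ) < 2 ^ a := by positivity
  have hx := x.2.1
  rw [coe_dyadicNode, div_le_iff₀ h2]
  exact Nat.floor_le (by positivity)

theorem le_dyadicNode_add (a : ℕ) (x : I) : (x : ℝ) ≤ dyadicNode a x + (2 ^ a)⁻¹ := by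
  have h2 : (0 : ℝ) < 2 ^ a := by positivity
  rw [coe_dyadicNode, ← one_div, ← add_div, le_div_iff₀ h2]
  exact (Nat.lt_floor_add_one _).le

theorem dyadicNode_le_succ (a : ℕ) (x : I) : (dyadicNode a x : ℝ) ≤ dyadicNode (a + 1) x := by
  have h2 : (0 : ℝ) < 2 ^ a := by positivity
  have h : 2 * ⌊(x : ℝ) * 2 ^ a⌋₊ ≤ ⌊(x : ℝ) * 2 ^ (a + 1)⌋₊ := by
    have := floor_mul_two_pow_add x a 1
    omega
  have h' : 2 * (⌊(x : ℝ) * 2 ^ a⌋₊ : ℝ) ≤ ⌊(x : ℝ) * 2 ^ (a + 1)⌋₊ := by exact_mod_cast h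
  rw [coe_dyadicNode, coe_dyadicNode, div_le_div_iff₀ h2 (by positivity), pow_succ]
  rw [pow_succ] at h'
  nlinarith

theorem abs_sub_dyadicNode_le (a : ℕ) (x : I) : |(x : ℝ) - dyadicNode a x| ≤ (2 ^ a)⁻¹ := by
  rw [abs_of_nonneg (sub_nonneg.2 (dyadicNode_le a x))]
  linarith [le_dyadicNode_add a x]

theorem abs_dyadicNode_succ_sub_le (a : ℕ) (x : I) :
    |(dyadicNode (a + 1) x : ℝ) - dyadicNode a x| ≤ (2 ^ a)⁻¹ := by
  rw [abs_of_nonneg (sub_nonneg.2 (dyadicNode_le_succ a x))]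
  linarith [le_dyadicNode_add a x, dyadicNode_le (a + 1) x]

/-- The function sampled at the lower left corners of the dyadic rectangles of a given shape. -/
def dyadicSample (f : I × I → ℝ) (a b : ℕ) (p : I × I) : ℝ :=
  f (dyadicNode a p.1, dyadicNode b p.2)

theorem dyadicSample_eq_sum (f : I × I → ℝ) (a b : ℕ) {p : I × I} (hp : p ∈ openUnitSquare) :
    dyadicSample f a b p = ∑ i : Fin (2 ^ a), ∑ j : Fin (2 ^ b),
      f (Set.projIcc 0 1 zero_le_one ((i : ℕ) / 2 ^ a : ℝ),
        Set.projIcc 0 1 zero_le_one ((j : ℕ) / 2 ^ b : ℝ)) * rectInd a i b j p := by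
  have h1 := sum_dyadicInd_mul p.1.2.1 hp.1 a (fun i => f (Set.projIcc 0 1 zero_le_one
    ((i : ℕ) / 2 ^ a : ℝ), dyadicNode b p.2))
  rw [dyadicSample, dyadicNode, ← h1]
  refine Finset.sum_congr rfl fun i _ => ?_
  have h2 := sum_dyadicInd_mul p.2.2.1 hp.2 b (fun j => f (Set.projIcc 0 1 zero_le_one
    ((i : ℕ) / 2 ^ a : ℝ), Set.projIcc 0 1 zero_le_one ((j : ℕ) / 2 ^ b : ℝ)))
  rw [dyadicNode, ← h2, Finset.mul_sum]
  exact Finset.sum_congr rfl fun j _ => by rw [rectInd]; ring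

theorem dyadicSample_mem_embedRange_of_rectInd (f : I × I → ℝ) {m a b : ℕ}
    (h : ∀ i < 2 ^ a, ∀ j < 2 ^ b, rectInd a i b j ∈ embedRange m) :
    dyadicSample f a b ∈ embedRange m := by
  have hs : ∑ i : Fin (2 ^ a), ∑ j : Fin (2 ^ b),
      f (Set.projIcc 0 1 zero_le_one ((i : ℕ) / 2 ^ a : ℝ),
        Set.projIcc 0 1 zero_le_one ((j : ℕ) / 2 ^ b : ℝ)) • rectInd a i b j ∈ embedRange m :=
    sum_mem fun i _ => sum_mem fun j _ => (embedRange m).smul_mem _ (h i i.2 j j.2)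
  refine embedRange_congr hs fun p hp => ?_
  rw [dyadicSample_eq_sum f a b hp]
  simp only [Finset.sum_apply, Pi.smul_apply, smul_eq_mul]

theorem dyadicSample_mem_embedRange (f : I × I → ℝ) {m a b : ℕ} (h : a + b = m) :
    dyadicSample f a b ∈ embedRange m :=
  dyadicSample_mem_embedRange_of_rectInd f fun _ hi _ hj => rectInd_mem_embedRange h hi hj

theorem dyadicSample_mem_embedRange_of_succ (f : I × I → ℝ) {m a b : ℕ} (h : a + b + 1 = m) :
    dyadicSample f a b ∈ embedRange m := by
  refine dyadicSample_mem_embedRange_of_rectInd f fun i hi j hj => ?_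
  rw [rectInd_split_snd]
  exact add_mem (rectInd_mem_embedRange (by omega) hi (by rw [pow_succ]; omega))
    (rectInd_mem_embedRange (by omega) hi (by rw [pow_succ]; omega))

/-- The sparse-grid interpolant. -/
def sparseGrid (f : I × I → ℝ) (m : ℕ) : I × I → ℝ :=
  ∑ k ∈ Finset.range m, (dyadicSample f k (m - k) - dyadicSample f k (m - (k + 1)))
    + dyadicSample f m 0

theorem sparseGrid_mem_embedRange (f : I × I → ℝ) (m : ℕ) : sparseGrid f m ∈ embedRange m := by
  refine add_mem (sum_mem fun k hk => ?_) (dyadicSample_mem_embedRange f (by simp))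
  have hk := Finset.mem_range.1 hk
  exact sub_mem (dyadicSample_mem_embedRange f (by omega))
    (dyadicSample_mem_embedRange_of_succ f (by omega))

theorem abs_sub_sparseGrid_le {c α : ℝ} (hc : 0 < c) (hα : 0 < α) {f : I × I → ℝ}
    (hf : IsMixedHolder c α f) (m : ℕ) (p : I × I) :
    |f p - sparseGrid f m p| ≤ (m + 2) * (c * (2 * (2 ^ m)⁻¹) ^ α) := by
  obtain ⟨x, y⟩ := p
  obtain ⟨hf1, hf2, hf3⟩ := hf
  have htel : ∑ k ∈ Finset.range m,
      (f (x, dyadicNode (m - k) y) - f (x, dyadicNode (m - (k + 1)) y)) =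
      f (x, dyadicNode m y) - f (x, dyadicNode 0 y) := by
    rw [Finset.sum_range_sub' (fun k => f (x, dyadicNode (m - k) y))]
    simp
  have hmono : (((2 : ℝ) ^ m)⁻¹) ^ α ≤ (2 * (2 ^ m)⁻¹) ^ α := by
    have : (0 : ℝ) ≤ (2 ^ m)⁻¹ := by positivity
    exact Real.rpow_le_rpow (by positivity) (by linarith) hα.le
  -- Telescoping in `y` rewrites the error as two one-variable differences and `m` mixed
  -- differences; the `k`-th has sides at most 2⁻ᵏ and 2^(-(m-k-1)), whose product is 2·2⁻ᵐ for
  -- every `k`.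
  have e : f (x, y) - sparseGrid f m (x, y) = (f (x, y) - f (x, dyadicNode m y))
      + (f (x, dyadicNode 0 y) - f (dyadicNode m x, dyadicNode 0 y))
      + ∑ k ∈ Finset.range m, (f (x, dyadicNode (m - k) y)
        - f (dyadicNode k x, dyadicNode (m - k) y)
        - f (x, dyadicNode (m - (k + 1)) y) + f (dyadicNode k x, dyadicNode (m - (k + 1)) y)) := by
    have : ∑ k ∈ Finset.range m, (f (x, dyadicNode (m - k) y)
        - f (dyadicNode k x, dyadicNode (m - k) y)
        - f (x, dyadicNode (m - (k + 1)) y) + f (dyadicNode k x, dyadicNode (m - (k + 1)) y))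
        = ∑ k ∈ Finset.range m, (f (x, dyadicNode (m - k) y) - f (x, dyadicNode (m - (k + 1)) y))
          - ∑ k ∈ Finset.range m, (f (dyadicNode k x, dyadicNode (m - k) y)
            - f (dyadicNode k x, dyadicNode (m - (k + 1)) y)) := by
      rw [← Finset.sum_sub_distrib]
      exact Finset.sum_congr rfl fun k _ => by ring
    rw [this, htel]
    simp only [sparseGrid, Pi.add_apply, Finset.sum_apply, Pi.sub_apply, dyadicSample]
    ring
  have b1 : |f (x, y) - f (x, dyadicNode m y)| ≤ c * (2 * (2 ^ m)⁻¹) ^ α := by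
    refine (hf2 _ _ _).trans (mul_le_mul_of_nonneg_left (le_trans ?_ hmono) hc.le)
    exact Real.rpow_le_rpow (abs_nonneg _) (abs_sub_dyadicNode_le m y) hα.le
  have b2 : |f (x, dyadicNode 0 y) - f (dyadicNode m x, dyadicNode 0 y)|
      ≤ c * (2 * (2 ^ m)⁻¹) ^ α := by
    refine (hf1 _ _ _).trans (mul_le_mul_of_nonneg_left (le_trans ?_ hmono) hc.le)
    exact Real.rpow_le_rpow (abs_nonneg _) (abs_sub_dyadicNode_le m x) hα.le
  have b3 : ∀ k ∈ Finset.range m,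
      |f (x, dyadicNode (m - k) y) - f (dyadicNode k x, dyadicNode (m - k) y)
        - f (x, dyadicNode (m - (k + 1)) y) + f (dyadicNode k x, dyadicNode (m - (k + 1)) y)|
      ≤ c * (2 * (2 ^ m)⁻¹) ^ α := by
    intro k hk
    obtain ⟨d, rfl⟩ := Nat.exists_eq_add_of_lt (Finset.mem_range.1 hk)
    rw [show k + d + 1 - k = d + 1 by omega, show k + d + 1 - (k + 1) = d by omega]
    refine (hf3 _ _ _ _).trans (mul_le_mul_of_nonneg_left ?_ hc.le)
    refine Real.rpow_le_rpow (by positivity) ?_ hα.le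
    calc _ ≤ ((2 : ℝ) ^ k)⁻¹ * (2 ^ d)⁻¹ := mul_le_mul (abs_sub_dyadicNode_le k x)
          (abs_dyadicNode_succ_sub_le d y) (abs_nonneg _) (by positivity)
      _ = _ := by rw [pow_succ, pow_add]; field_simp
  rw [e]
  calc _ ≤ c * (2 * (2 ^ m)⁻¹) ^ α + c * (2 * (2 ^ m)⁻¹) ^ α
        + ∑ k ∈ Finset.range m, c * (2 * (2 ^ m)⁻¹) ^ α :=
      (abs_add_le _ _).trans (add_le_add ((abs_add_le _ _).trans (add_le_add b1 b2))
        ((Finset.abs_sum_le_sum_abs _ _).trans (Finset.sum_le_sum b3)))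
    _ = _ := by
      rw [Finset.sum_const, Finset.card_range, nsmul_eq_mul]
      ring

theorem exists_abs_sub_embed_dotProduct_le {c α : ℝ} (hc : 0 < c) (hα : 0 < α) {f : I × I → ℝ}
    (hf : IsMixedHolder c α f) (m : ℕ) (t : ℝ) :
    ∃ z, ∀ p ∈ openUnitSquare,
      |f p - t - embed m p ⬝ᵥ z| ≤ (m + 2) * (c * (2 * (2 ^ m)⁻¹) ^ α) := by
  obtain ⟨w, hw⟩ := sparseGrid_mem_embedRange f m
  refine ⟨w - t • constVec m, fun p hp => ?_⟩
  rw [dotProduct_sub, dotProduct_smul, embed_dotProduct_constVec hp, ← hw p hp, smul_eq_mul, mul_one,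
    sub_sub_sub_cancel_right]
  exact abs_sub_sparseGrid_le hc hα hf m p

/-! ### Oscillation of `f`, and rigidity for exponents above one. -/

theorem IsMixedHolder.abs_sub_le {c α : ℝ} (hc : 0 < c) (hα : 0 < α) {f : I × I → ℝ}
    (hf : IsMixedHolder c α f) (p q : I × I) : |f p - f q| ≤ 2 * c := by
  have h (x y : I) : |(x : ℝ) - y| ^ α ≤ 1 :=
    Real.rpow_le_one (abs_nonneg _)
      (abs_le.2 ⟨by linarith [x.2.1, y.2.2], by linarith [x.2.2, y.2.1]⟩) hα.le
  have h1 := (hf.1 q.1 p.1 p.2).trans (mul_le_mul_of_nonneg_left (h p.1 q.1) hc.le)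
  have h2 := (hf.2.1 q.1 q.2 p.2).trans (mul_le_mul_of_nonneg_left (h p.2 q.2) hc.le)
  have e : f p - f q = (f (p.1, p.2) - f (q.1, p.2)) + (f (q.1, p.2) - f (q.1, q.2)) := by simp
  rw [e]
  exact (abs_add_le _ _).trans (by linarith)

theorem eq_of_abs_sub_le_rpow {c α : ℝ} (hα : 1 < α) {g : I → ℝ}
    (hg : ∀ x x' : I, |g x' - g x| ≤ c * |(x' : ℝ) - x| ^ α) (x x' : I) : g x = g x' := by
  have hc : 0 ≤ c := by simpa using (abs_nonneg _).trans (hg 0 1)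
  -- Extending by the endpoint values keeps the Hölder bound and makes the derivative vanish on all
  -- of ℝ, with no boundary points to treat.
  set F : ℝ → ℝ := fun t => g (Set.projIcc 0 1 zero_le_one t) with hF
  have hFb (s t : ℝ) : |F t - F s| ≤ c * |t - s| ^ α := by
    refine (hg _ _).trans (mul_le_mul_of_nonneg_left ?_ hc)
    exact Real.rpow_le_rpow (abs_nonneg _) (Set.abs_projIcc_sub_projIcc zero_le_one) (by linarith)
  have hd (s : ℝ) : HasDerivAt F 0 s := by
    rw [hasDerivAt_iff_isLittleO]
    simp only [smul_zero, sub_zero]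
    have hO : (fun t => F t - F s) =O[nhds s] fun t => |t - s| ^ α :=
      Asymptotics.IsBigO.of_bound c (.of_forall fun t => by
        rw [Real.norm_eq_abs, Real.norm_eq_abs, abs_of_nonneg (Real.rpow_nonneg (abs_nonneg _) _)]
        exact hFb s t)
    refine hO.trans_isLittleO ?_
    have h0 : Filter.Tendsto (fun t : ℝ => |t - s| ^ (α - 1)) (nhds s) (nhds 0) := by
      have hcont : Continuous fun t : ℝ => |t - s| ^ (α - 1) :=
        (by fun_prop : Continuous fun t : ℝ => |t - s|).rpow_const fun _ => Or.inr (by linarith)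
      have := hcont.tendsto s
      simpa [Real.zero_rpow (by linarith : α - 1 ≠ 0)] using this
    have h1 : (fun t : ℝ => |t - s| ^ α) = fun t => |t - s| ^ (α - 1) * |t - s| := by
      ext t
      rw [← Real.rpow_add_one' (abs_nonneg _) (by linarith), sub_add_cancel]
    rw [h1]
    have h2 := ((Asymptotics.isLittleO_one_iff ℝ).2 h0).mul_isBigO
      (Asymptotics.isBigO_refl (fun t : ℝ => |t - s|) (nhds s))
    simp only [one_mul] at h2
    exact (Asymptotics.isLittleO_abs_right).1 h2
  have := is_const_of_deriv_eq_zero (fun s => (hd s).differentiableAt) (fun s => (hd s).deriv) x x'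
  simpa [hF] using this

theorem IsMixedHolder.eq_of_one_lt {c α : ℝ} (hα : 1 < α) {f : I × I → ℝ}
    (hf : IsMixedHolder c α f) (p q : I × I) : f p = f q := by
  have h1 := eq_of_abs_sub_le_rpow hα (g := fun x => f (x, p.2)) (fun x x' => hf.1 x x' p.2) p.1 q.1
  have h2 := eq_of_abs_sub_le_rpow hα (g := fun y => f (q.1, y)) (hf.2.1 q.1) p.2 q.2
  exact h1.trans h2

/-! ### Kaczmarz iteration: linearity, stability and expected contraction. -/

/-- One homogeneous Kaczmarz step. -/
def kaczmarzProj (m : ℕ) (p : I × I) (w : EmbIndex m → ℝ) : EmbIndex m → ℝ :=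
  w - ((embed m p ⬝ᵥ w) / (1 + (m : ℝ) / 2)) • embed m p

/-- The error of the Kaczmarz iterates for a consistent system with solution `w`. -/
def kaczmarzError (m : ℕ) {l : ℕ} (x : Fin l → I × I) (w : EmbIndex m → ℝ) (k : ℕ) :
    EmbIndex m → ℝ :=
  w - kaczmarz m x (fun i => embed m (x i) ⬝ᵥ w) k

theorem kaczmarzError_zero (m : ℕ) {l : ℕ} (x : Fin l → I × I) (w : EmbIndex m → ℝ) :
    kaczmarzError m x w 0 = w := by
  simp [kaczmarzError, kaczmarz]

theorem kaczmarzError_succ (m : ℕ) {l : ℕ} (x : Fin l → I × I) (w : EmbIndex m → ℝ) {k : ℕ}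
    (hk : k < l) :
    kaczmarzError m x w (k + 1) = kaczmarzProj m (x ⟨k, hk⟩) (kaczmarzError m x w k) := by
  simp only [kaczmarzError, kaczmarz, hk, dif_pos, kaczmarzProj, dotProduct_sub]
  abel

theorem kaczmarzError_succ_of_le (m : ℕ) {l : ℕ} (x : Fin l → I × I) (w : EmbIndex m → ℝ) {k : ℕ}
    (hk : ¬k < l) : kaczmarzError m x w (k + 1) = kaczmarzError m x w k := by
  simp only [kaczmarzError, kaczmarz, hk, dif_neg, not_false_eq_true]

theorem kaczmarz_add_mul (m : ℕ) {l : ℕ} (x : Fin l → I × I) (b b' : Fin l → ℝ) (t : ℝ) (k : ℕ) :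
    kaczmarz m x (fun i => b i + t * b' i) k = kaczmarz m x b k + t • kaczmarz m x b' k := by
  induction k with
  | zero => simp [kaczmarz]
  | succ k ih =>
    by_cases hk : k < l
    · simp only [kaczmarz, hk, dif_pos, ih, dotProduct_add, dotProduct_smul, smul_eq_mul]
      ext a
      simp only [Pi.add_apply, Pi.smul_apply, smul_eq_mul]
      ring
    · simp only [kaczmarz, hk, dif_neg, not_false_eq_true, ih]

theorem kaczmarz_zero (m : ℕ) {l : ℕ} (x : Fin l → I × I) (k : ℕ) :
    kaczmarz m x (fun _ => 0) k = 0 := by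
  induction k with
  | zero => rfl
  | succ k ih => by_cases hk : k < l <;> simp [kaczmarz, hk, ih]

/-- Pythagoras: 1 + m/2 is exactly |Ψ(p)|², so the step is the orthogonal projection along Ψ(p). -/
theorem kaczmarzProj_dotProduct_self {m : ℕ} {p : I × I} (hp : p ∈ openUnitSquare)
    (w : EmbIndex m → ℝ) : kaczmarzProj m p w ⬝ᵥ kaczmarzProj m p w =
      w ⬝ᵥ w - (embed m p ⬝ᵥ w) ^ 2 / (1 + (m : ℝ) / 2) := by
  have h := embed_dotProduct_embed (m := m) hp
  have hρ : (1 + (m : ℝ) / 2) ≠ 0 := by positivity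
  simp only [kaczmarzProj, dotProduct_sub, sub_dotProduct, smul_dotProduct, dotProduct_smul,
    smul_eq_mul, h, dotProduct_comm w (embed m p)]
  field_simp
  ring

theorem kaczmarzProj_dotProduct_self_le {m : ℕ} {p : I × I} (hp : p ∈ openUnitSquare)
    (w : EmbIndex m → ℝ) : kaczmarzProj m p w ⬝ᵥ kaczmarzProj m p w ≤ w ⬝ᵥ w := by
  rw [kaczmarzProj_dotProduct_self hp]
  have : 0 ≤ (embed m p ⬝ᵥ w) ^ 2 / (1 + (m : ℝ) / 2) := by positivity
  linarith

theorem kaczmarzError_dotProduct_self_le {m l : ℕ} {x : Fin l → I × I}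
    (hx : ∀ i, x i ∈ openUnitSquare) (w : EmbIndex m → ℝ) (k : ℕ) :
    kaczmarzError m x w k ⬝ᵥ kaczmarzError m x w k ≤ w ⬝ᵥ w := by
  induction k with
  | zero => rw [kaczmarzError_zero]
  | succ k ih =>
    by_cases hk : k < l
    · rw [kaczmarzError_succ m x w hk]
      exact (kaczmarzProj_dotProduct_self_le (hx _) _).trans ih
    · rwa [kaczmarzError_succ_of_le m x w hk]

/-- Each step projects the iterate orthogonally to Ψ(x_k) and adds the orthogonal vector
(e_k/|Ψ|²)Ψ(x_k), so squared norms grow additively rather than norms. -/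
theorem kaczmarz_dotProduct_self_le {m l : ℕ} {x : Fin l → I × I}
    (hx : ∀ i, x i ∈ openUnitSquare) {e : Fin l → ℝ} {ε : ℝ} (he : ∀ i, |e i| ≤ ε) (k : ℕ) :
    kaczmarz m x e k ⬝ᵥ kaczmarz m x e k ≤ k * (ε ^ 2 / (1 + (m : ℝ) / 2)) := by
  induction k with
  | zero => simp [kaczmarz]
  | succ k ih =>
    have hρ : 0 < (1 + (m : ℝ) / 2) := by positivity
    have hε : 0 ≤ ε ^ 2 / (1 + (m : ℝ) / 2) := by positivity
    push_cast
    by_cases hk : k < l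
    · simp only [kaczmarz, hk, dif_pos]
      set v := kaczmarz m x e k
      have h := embed_dotProduct_embed (m := m) (hx ⟨k, hk⟩)
      have key : (v + ((e ⟨k, hk⟩ - embed m (x ⟨k, hk⟩) ⬝ᵥ v) / (1 + (m : ℝ) / 2)) •
          embed m (x ⟨k, hk⟩)) ⬝ᵥ (v + ((e ⟨k, hk⟩ - embed m (x ⟨k, hk⟩) ⬝ᵥ v) /
            (1 + (m : ℝ) / 2)) • embed m (x ⟨k, hk⟩)) =
          v ⬝ᵥ v - (embed m (x ⟨k, hk⟩) ⬝ᵥ v) ^ 2 / (1 + (m : ℝ) / 2)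
            + (e ⟨k, hk⟩) ^ 2 / (1 + (m : ℝ) / 2) := by
        simp only [dotProduct_add, add_dotProduct, smul_dotProduct, dotProduct_smul,
          smul_eq_mul, h, dotProduct_comm v (embed m (x ⟨k, hk⟩))]
        field_simp
        ring
      rw [key]
      have h1 : 0 ≤ (embed m (x ⟨k, hk⟩) ⬝ᵥ v) ^ 2 / (1 + (m : ℝ) / 2) := by positivity
      have h2 : (e ⟨k, hk⟩) ^ 2 / (1 + (m : ℝ) / 2) ≤ ε ^ 2 / (1 + (m : ℝ) / 2) := by
        rw [← sq_abs]
        gcongr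
        exact he _
      linarith
    · simp only [kaczmarz, hk, dif_neg, not_false_eq_true]
      linarith

theorem kaczmarzError_congr (m : ℕ) {l : ℕ} {x y : Fin l → I × I} (w : EmbIndex m → ℝ) {k : ℕ}
    (h : ∀ i : Fin l, (i : ℕ) < k → x i = y i) : kaczmarzError m x w k = kaczmarzError m y w k := by
  induction k with
  | zero => simp only [kaczmarzError_zero]
  | succ k ih =>
    have ih := ih fun i hi => h i (by omega)
    by_cases hk : k < l
    · rw [kaczmarzError_succ m x w hk, kaczmarzError_succ m y w hk, ih, h ⟨k, hk⟩ (by simp)]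
    · rw [kaczmarzError_succ_of_le m x w hk, kaczmarzError_succ_of_le m y w hk, ih]

theorem measurable_kaczmarzProj (m : ℕ) :
    Measurable fun q : (EmbIndex m → ℝ) × (I × I) => kaczmarzProj m q.2 q.1 := by
  have h := measurable_embed_apply m
  refine measurable_pi_lambda _ fun a => ?_
  simp only [kaczmarzProj, Pi.sub_apply, Pi.smul_apply, smul_eq_mul, dotProduct]
  fun_prop

theorem measurable_kaczmarzError (m l : ℕ) (w : EmbIndex m → ℝ) (k : ℕ) :
    Measurable fun x : Fin l → I × I => kaczmarzError m x w k := by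
  induction k with
  | zero => simp only [kaczmarzError_zero, measurable_const]
  | succ k ih =>
    by_cases hk : k < l
    · simp only [fun x => kaczmarzError_succ m x w hk]
      exact (measurable_kaczmarzProj m).comp (ih.prodMk (measurable_pi_apply _))
    · simpa only [fun x => kaczmarzError_succ_of_le m x w hk] using ih

theorem measurable_dotProduct_self (ι : Type*) [Fintype ι] :
    Measurable fun w : ι → ℝ => w ⬝ᵥ w := by
  simp only [dotProduct]
  fun_prop

theorem inv_two_pow_div_le_one (m : ℕ) : ((2 : ℝ) ^ m)⁻¹ / (1 + (m : ℝ) / 2) ≤ 1 := by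
  have h1 : ((2 : ℝ) ^ m)⁻¹ ≤ 1 := inv_le_one_of_one_le₀ (one_le_pow₀ (by norm_num))
  have h2 : (0 : ℝ) ≤ m := by positivity
  rw [div_le_one (by positivity)]
  linarith

theorem dotProduct_self_nonneg_real {ι : Type*} [Fintype ι] (w : ι → ℝ) : 0 ≤ w ⬝ᵥ w :=
  Finset.sum_nonneg fun i _ => mul_self_nonneg (w i)

/-- The removed term averages to 2⁻ᵐ|w|²/(1 + m/2) by orthogonality of the coordinates, the same
fraction for every direction of `w`. -/
theorem lintegral_kaczmarzProj (m : ℕ) (w : EmbIndex m → ℝ) :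
    ∫⁻ p : I × I, ENNReal.ofReal (kaczmarzProj m p w ⬝ᵥ kaczmarzProj m p w) =
      ENNReal.ofReal (1 - ((2 : ℝ) ^ m)⁻¹ / (1 + (m : ℝ) / 2)) * ENNReal.ofReal (w ⬝ᵥ w) := by
  have hae : ∀ᵐ p : I × I, kaczmarzProj m p w ⬝ᵥ kaczmarzProj m p w =
      w ⬝ᵥ w - (embed m p ⬝ᵥ w) ^ 2 / (1 + (m : ℝ) / 2) :=
    ae_mem_openUnitSquare.mono fun p hp => kaczmarzProj_dotProduct_self hp w
  have hint : Integrable fun p : I × I => w ⬝ᵥ w - (embed m p ⬝ᵥ w) ^ 2 / (1 + (m : ℝ) / 2) :=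
    (integrable_const _).sub ((integrable_sq_embed_dotProduct m w).div_const _)
  rw [lintegral_congr_ae (hae.mono fun p hp => congrArg ENNReal.ofReal hp),
    ← ofReal_integral_eq_lintegral_ofReal hint,
    ← ENNReal.ofReal_mul (sub_nonneg.2 (inv_two_pow_div_le_one m)),
    integral_sub (integrable_const _) ((integrable_sq_embed_dotProduct m w).div_const _),
    integral_div, integral_sq_embed_dotProduct]
  · simp
    ring_nf
  · filter_upwards [hae] with p hp
    rw [← hp]
    exact dotProduct_self_nonneg_real _

theorem lintegral_kaczmarzError {Ω : Type*} [MeasurableSpace Ω] {P : Measure Ω}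
    [IsProbabilityMeasure P] {l : ℕ} {X : Fin l → Ω → I × I} (hX : ∀ i, Measurable (X i))
    (hind : iIndepFun X P) (hlaw : ∀ i, P.map (X i) = (volume : Measure (I × I))) (m : ℕ)
    (w : EmbIndex m → ℝ) {k : ℕ} (hk : k ≤ l) :
    ∫⁻ ω, ENNReal.ofReal (kaczmarzError m (fun i => X i ω) w k ⬝ᵥ
        kaczmarzError m (fun i => X i ω) w k) ∂P =
      ENNReal.ofReal (1 - ((2 : ℝ) ^ m)⁻¹ / (1 + (m : ℝ) / 2)) ^ k * ENNReal.ofReal (w ⬝ᵥ w) := by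
  classical
  induction k with
  | zero => simp [kaczmarzError_zero]
  | succ k ih =>
    have hk' : k < l := by omega
    have hXm : Measurable fun ω i => X i ω := measurable_pi_lambda _ hX
    have hE : Measurable fun ω => kaczmarzError m (fun i => X i ω) w k :=
      (measurable_kaczmarzError m l w k).comp hXm
    -- The error after `k` steps depends only on the samples before index `k`. The remaining ones
    -- are replaced by the dummy point (0, 0), which `kaczmarzError_congr` shows to be harmless.
    have hindep : IndepFun (fun ω => kaczmarzError m (fun i => X i ω) w k) (X ⟨k, hk'⟩) P := by
      set S : Finset (Fin l) := Finset.univ.filter fun i => (i : ℕ) < k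
      have h := hind.indepFun_finset S {⟨k, hk'⟩} (by simp [S]) hX
      have hext : Measurable fun (y : S → I × I) (i : Fin l) =>
          if hi : i ∈ S then y ⟨i, hi⟩ else (0, 0) := by
        refine measurable_pi_lambda _ fun i => ?_
        by_cases hi : i ∈ S
        · simpa only [hi, dif_pos] using measurable_pi_apply _
        · simp only [hi, dif_neg, not_false_eq_true, measurable_const]
      have h' := h.comp ((measurable_kaczmarzError m l w k).comp hext)
        (measurable_pi_apply (⟨⟨k, hk'⟩, by simp⟩ : ({⟨k, hk'⟩} : Finset (Fin l))))
      convert h' using 1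
      · ext1 ω
        refine kaczmarzError_congr m w fun i hi => ?_
        simp [S, hi]
      · rfl
    have hmap : P.map (fun ω => (kaczmarzError m (fun i => X i ω) w k, X ⟨k, hk'⟩ ω)) =
        (P.map fun ω => kaczmarzError m (fun i => X i ω) w k).prod volume := by
      rw [(indepFun_iff_map_prod_eq_prod_map_map hE.aemeasurable (hX _).aemeasurable).1 hindep,
        hlaw]
    have : IsProbabilityMeasure (P.map fun ω => kaczmarzError m (fun i => X i ω) w k) :=
      Measure.isProbabilityMeasure_map hE.aemeasurable
    have hmeas : Measurable fun q : (EmbIndex m → ℝ) × (I × I) =>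
        ENNReal.ofReal (kaczmarzProj m q.2 q.1 ⬝ᵥ kaczmarzProj m q.2 q.1) :=
      ENNReal.measurable_ofReal.comp
        ((measurable_dotProduct_self _).comp (measurable_kaczmarzProj m))
    simp only [fun ω => kaczmarzError_succ m (fun i => X i ω) w hk']
    rw [← lintegral_map (f := fun q : (EmbIndex m → ℝ) × (I × I) =>
        ENNReal.ofReal (kaczmarzProj m q.2 q.1 ⬝ᵥ kaczmarzProj m q.2 q.1))
        (g := fun ω => (kaczmarzError m (fun i => X i ω) w k, X ⟨k, hk'⟩ ω)) hmeas
        (hE.prodMk (hX _)), hmap, lintegral_prod _ hmeas.aemeasurable]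
    simp only [lintegral_kaczmarzProj]
    have hd : Measurable fun w : EmbIndex m → ℝ => ENNReal.ofReal (w ⬝ᵥ w) :=
      ENNReal.measurable_ofReal.comp (measurable_dotProduct_self _)
    rw [lintegral_const_mul _ hd, lintegral_map hd hE, ih hk'.le, pow_succ', mul_assoc]

/-! ### From coefficient vectors to the L² error. -/

theorem eLpNorm_embed_dotProduct (m : ℕ) (w : EmbIndex m → ℝ) :
    eLpNorm (fun p : I × I => embed m p ⬝ᵥ w) 2 volume =
      ENNReal.ofReal √(((2 : ℝ) ^ m)⁻¹ * (w ⬝ᵥ w)) := by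
  have hm : Measurable fun p : I × I => embed m p ⬝ᵥ w := by
    have h := measurable_embed_apply m
    simp only [dotProduct]
    fun_prop
  have hL : MemLp (fun p : I × I => embed m p ⬝ᵥ w) 2 volume :=
    (memLp_two_iff_integrable_sq hm.aestronglyMeasurable).2 (integrable_sq_embed_dotProduct m w)
  rw [hL.eLpNorm_eq_integral_rpow_norm two_ne_zero ENNReal.ofNat_ne_top,
    ← integral_sq_embed_dotProduct, Real.sqrt_eq_rpow]
  simp

theorem eLpNorm_le_of_abs_sub_embed_le {m : ℕ} {g : I × I → ℝ} {ε : ℝ} (hε : 0 ≤ ε)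
    {w : EmbIndex m → ℝ} (h : ∀ p ∈ openUnitSquare, |g p - embed m p ⬝ᵥ w| ≤ ε) :
    eLpNorm g 2 volume ≤ ENNReal.ofReal (ε + √(((2 : ℝ) ^ m)⁻¹ * (w ⬝ᵥ w))) := by
  have hm : Measurable fun p : I × I => embed m p ⬝ᵥ w := by
    have h := measurable_embed_apply m
    simp only [dotProduct]
    fun_prop
  -- Minkowski's inequality is applied to a measurable majorant, so `g` itself need not be
  -- measurable.
  have h1 : eLpNorm g 2 volume ≤
      eLpNorm ((fun _ : I × I => ε) + fun p : I × I => ‖embed m p ⬝ᵥ w‖) 2 volume := by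
    refine eLpNorm_mono_ae_real (ae_mem_openUnitSquare.mono fun p hp => ?_)
    have := abs_add_le (g p - embed m p ⬝ᵥ w) (embed m p ⬝ᵥ w)
    rw [sub_add_cancel] at this
    exact this.trans (add_le_add_left (h p hp) _)
  refine h1.trans ((eLpNorm_add_le aestronglyMeasurable_const
    hm.norm.aestronglyMeasurable one_le_two).trans ?_)
  rw [eLpNorm_norm, eLpNorm_embed_dotProduct, ENNReal.ofReal_add hε (Real.sqrt_nonneg _),
    eLpNorm_const' _ two_ne_zero ENNReal.ofNat_ne_top]
  simp [Real.enorm_eq_ofReal hε]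

theorem inv_two_pow_mul_dotProduct_self_le {m : ℕ} {w : EmbIndex m → ℝ} {b : ℝ}
    (h : ∀ p ∈ openUnitSquare, |embed m p ⬝ᵥ w| ≤ b) :
    ((2 : ℝ) ^ m)⁻¹ * (w ⬝ᵥ w) ≤ b ^ 2 := by
  rw [← integral_sq_embed_dotProduct]
  calc _ ≤ ∫ _ : I × I, b ^ 2 := by
        refine integral_mono_ae (integrable_sq_embed_dotProduct m w) (integrable_const _)
          (ae_mem_openUnitSquare.mono fun p hp => ?_)
        exact sq_le_sq' (abs_le.1 (h p hp)).1 (abs_le.1 (h p hp)).2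
    _ = b ^ 2 := by simp

theorem dotProduct_self_sub_smul_sub_le {ι : Type*} [Fintype ι] (a b r : ι → ℝ) (t : ℝ) :
    (a - t • b - r) ⬝ᵥ (a - t • b - r) ≤ 3 * (a ⬝ᵥ a + t ^ 2 * (b ⬝ᵥ b) + r ⬝ᵥ r) := by
  simp only [dotProduct, Finset.mul_sum, ← Finset.sum_add_distrib]
  refine Finset.sum_le_sum fun i _ => ?_
  simp only [Pi.sub_apply, Pi.smul_apply, smul_eq_mul]
  nlinarith [sq_nonneg (a i + t * b i), sq_nonneg (a i + r i), sq_nonneg (t * b i - r i)]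

theorem kaczmarzApprox_eq {m n l : ℕ} (hm : m = Nat.log 2 n) (c₁ : ℝ) (x : Fin l → I × I)
    (y : Fin l → ℝ) (p : I × I) : kaczmarzApprox c₁ n x y p = firstValue y +
      embed m p ⬝ᵥ kaczmarz m x (fun k => y k - firstValue y) ⌈c₁ * n * Real.log n ^ 2⌉₊ := by
  subst hm
  rfl

theorem eLpNorm_sub_kaczmarzApprox_le {c₁ : ℝ} {n l m : ℕ} (hm : m = Nat.log 2 n)
    (hl : 0 < l) {x : Fin l → I × I}
    (hx : ∀ i, x i ∈ openUnitSquare) {f : I × I → ℝ} {t₀ ε : ℝ} (hε : 0 ≤ ε)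
    {z : EmbIndex m → ℝ}
    (hz : ∀ p ∈ openUnitSquare, |f p - t₀ - embed m p ⬝ᵥ z| ≤ ε) :
    eLpNorm (f - kaczmarzApprox c₁ n x (fun i => f (x i))) 2 volume ≤
      ENNReal.ofReal (ε + √(((2 : ℝ) ^ m)⁻¹ * (3 *
        (kaczmarzError m x z ⌈c₁ * n * Real.log n ^ 2⌉₊ ⬝ᵥ
            kaczmarzError m x z ⌈c₁ * n * Real.log n ^ 2⌉₊
          + (f (x ⟨0, hl⟩) - t₀) ^ 2 *
            (kaczmarzError m x (constVec _) ⌈c₁ * n * Real.log n ^ 2⌉₊ ⬝ᵥ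
              kaczmarzError m x (constVec _) ⌈c₁ * n * Real.log n ^ 2⌉₊)
          + (⌈c₁ * n * Real.log n ^ 2⌉₊ : ℝ) * (ε ^ 2 / (1 + (m : ℝ) / 2)))))) := by
  have happ := kaczmarzApprox_eq hm c₁ x (fun i => f (x i))
  set L := ⌈c₁ * n * Real.log n ^ 2⌉₊
  set t := f (x ⟨0, hl⟩) - t₀ with ht
  set e : Fin l → ℝ := fun i => f (x i) - t₀ - embed m (x i) ⬝ᵥ z with he
  -- The random value f(x₀) enters only through the scalar `t`, so the two error vectors start from
  -- deterministic vectors and the contraction estimate applies to them.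
  have hv : kaczmarz m x (fun i => f (x i) - f (x ⟨0, hl⟩)) L =
      (z - kaczmarzError m x z L) - t • (constVec m - kaczmarzError m x (constVec m) L)
        + kaczmarz m x e L := by
    have h1 : (fun i => f (x i) - f (x ⟨0, hl⟩)) = fun i => (embed m (x i) ⬝ᵥ z +
        (-t) * (embed m (x i) ⬝ᵥ constVec m)) + 1 * e i := by
      ext i
      rw [embed_dotProduct_constVec (hx i)]
      simp only [he, ht]
      ring
    rw [h1, kaczmarz_add_mul, kaczmarz_add_mul]
    simp only [kaczmarzError, sub_sub_cancel, one_smul, neg_smul]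
    rw [sub_eq_add_neg]
  refine (eLpNorm_le_of_abs_sub_embed_le hε (w := kaczmarzError m x z L
    - t • kaczmarzError m x (constVec m) L - kaczmarz m x e L) fun p hp => ?_).trans ?_
  · have h2 : (f - kaczmarzApprox c₁ n x fun i => f (x i)) p - embed m p ⬝ᵥ
        (kaczmarzError m x z L - t • kaczmarzError m x (constVec m) L - kaczmarz m x e L) =
        f p - t₀ - embed m p ⬝ᵥ z := by
      simp only [Pi.sub_apply, happ, firstValue, hl, dif_pos]
      rw [hv]
      simp only [dotProduct_sub, dotProduct_add, dotProduct_smul, smul_eq_mul,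
        embed_dotProduct_constVec hp, ht]
      ring
    rw [h2]
    exact hz p hp
  · refine ENNReal.ofReal_le_ofReal (add_le_add le_rfl (Real.sqrt_le_sqrt ?_))
    refine mul_le_mul_of_nonneg_left ((dotProduct_self_sub_smul_sub_le _ _ _ _).trans ?_)
      (by positivity)
    have := kaczmarz_dotProduct_self_le (m := m) hx (fun i => hz (x i) (hx i)) (e := e) L
    linarith

/-! ### Numerical bounds and the probability of slow convergence. -/

theorem log_bounds {n : ℕ} (hn : 2 ≤ n) :
    1 ≤ Nat.log 2 n ∧ 1 / 2 ≤ Real.log n ∧ (Nat.log 2 n : ℝ) * Real.log 2 ≤ Real.log n ∧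
      (Nat.log 2 n + 2 : ℝ) ≤ 6 * Real.log n ∧ (2 : ℝ) ^ Nat.log 2 n ≤ n ∧
      (n : ℝ) ≤ 2 * 2 ^ Nat.log 2 n := by
  have h2 := Real.log_two_gt_d9
  have h1 : 1 ≤ Nat.log 2 n := Nat.log_pos (by norm_num) hn
  have hp : (2 : ℝ) ^ Nat.log 2 n ≤ n := by exact_mod_cast Nat.pow_log_le_self 2 (by omega)
  have hp' : (n : ℝ) ≤ 2 * 2 ^ Nat.log 2 n := by
    have := (Nat.lt_pow_succ_log_self (b := 2) (by norm_num) n).le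
    rw [pow_succ'] at this
    exact_mod_cast this
  have hlog : (Nat.log 2 n : ℝ) * Real.log 2 ≤ Real.log n := by
    rw [← Real.log_pow]
    exact Real.log_le_log (by positivity) hp
  have h1' : (1 : ℝ) ≤ Nat.log 2 n := by exact_mod_cast h1
  refine ⟨h1, by nlinarith, hlog, by nlinarith, hp, hp'⟩

/-- The threshold 55 is the first integer above e⁴; log n ≥ 4 suffices for 1 + m/2 ≤ log n, which
gives the full rate n^(-c₁) in `contraction_pow_le`. -/
theorem log_ge_four {n : ℕ} (hn : 55 ≤ n) : 4 ≤ Real.log n := by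
  rw [Real.le_log_iff_exp_le (by positivity)]
  have h := Real.exp_one_lt_d9
  have h4 : Real.exp 4 = Real.exp 1 ^ 4 := by rw [← Real.exp_nat_mul]; norm_num
  have hn' : (55 : ℝ) ≤ n := by exact_mod_cast hn
  have : Real.exp 1 ^ 4 ≤ 2.7182818286 ^ 4 := pow_le_pow_left₀ (Real.exp_pos _).le h.le 4
  rw [h4]
  refine this.trans (le_trans ?_ hn')
  norm_num

theorem contraction_pow_le {c₁ : ℝ} (hc₁ : 0 < c₁) {n : ℕ} (hn : 55 ≤ n) :
    (1 - ((2 : ℝ) ^ Nat.log 2 n)⁻¹ / (1 + (Nat.log 2 n : ℝ) / 2)) ^ ⌈c₁ * n * Real.log n ^ 2⌉₊ ≤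
      (n : ℝ) ^ (-c₁) := by
  obtain ⟨h1, h2, h3, h4, h5, h6⟩ := log_bounds (n := n) (by omega)
  have hs := log_ge_four hn
  have hl2 := Real.log_two_gt_d9
  have hq1 := inv_two_pow_div_le_one (Nat.log 2 n)
  have hL := Nat.le_ceil (c₁ * n * Real.log n ^ 2)
  set L := ⌈c₁ * n * Real.log n ^ 2⌉₊
  set m := Nat.log 2 n
  set s := Real.log n with hsdef
  have hn0 : (0 : ℝ) < n := by positivity
  have hρ : 1 + (m : ℝ) / 2 ≤ s := by nlinarith
  have hq : 1 / (n * s) ≤ ((2 : ℝ) ^ m)⁻¹ / (1 + (m : ℝ) / 2) := by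
    rw [← one_div, div_div]
    exact one_div_le_one_div_of_le (by positivity)
      (mul_le_mul h5 hρ (by positivity) (by positivity))
  set q := ((2 : ℝ) ^ m)⁻¹ / (1 + (m : ℝ) / 2)
  calc (1 - q) ^ L ≤ Real.exp (-q) ^ L :=
        pow_le_pow_left₀ (by linarith) (Real.one_sub_le_exp_neg q) L
    _ = Real.exp (-(q * L)) := by rw [← Real.exp_nat_mul]; ring_nf
    _ ≤ Real.exp (s * -c₁) := by
      refine Real.exp_le_exp.2 ?_
      have : 1 / (n * s) * (c₁ * n * s ^ 2) ≤ q * L :=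
        mul_le_mul hq hL (by positivity) (le_trans (by positivity) hq)
      have e : 1 / (n * s) * (c₁ * n * s ^ 2) = c₁ * s := by
        have : s ≠ 0 := by linarith
        field_simp
      linarith
    _ = (n : ℝ) ^ (-c₁) := by rw [Real.rpow_def_of_pos hn0]

theorem measure_kaczmarzError_gt_le {Ω : Type*} [MeasurableSpace Ω] {P : Measure Ω}
    [IsProbabilityMeasure P] {c₁ : ℝ} (hc₁ : 0 < c₁) {n l m : ℕ} (hm : m = Nat.log 2 n)
    (hn : 2 ≤ n)
    (hl : c₁ * n * Real.log n ^ 2 ≤ l) {X : Fin l → Ω → I × I} (hX : ∀ i, Measurable (X i))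
    (hind : iIndepFun X P) (hlaw : ∀ i, P.map (X i) = (volume : Measure (I × I)))
    (hsq : ∀ᵐ ω ∂P, ∀ i, X i ω ∈ openUnitSquare)
    {w : EmbIndex m → ℝ} {B : ℝ} (hB : 0 < B)
    (hw : ((2 : ℝ) ^ m)⁻¹ * (w ⬝ᵥ w) ≤ B * Real.log n ^ 2) :
    P.real {ω | 6050 * B * ((n : ℝ) ^ (-2 : ℝ) * Real.log n ^ 3) <
      ((2 : ℝ) ^ m)⁻¹ *
        (kaczmarzError m (fun i => X i ω) w ⌈c₁ * n * Real.log n ^ 2⌉₊ ⬝ᵥ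
          kaczmarzError m (fun i => X i ω) w ⌈c₁ * n * Real.log n ^ 2⌉₊)} ≤
      (n : ℝ) ^ (2 - c₁) / 2 := by
  obtain ⟨h1, h2, h3, h4, h5, h6⟩ := log_bounds hn
  have hcon := contraction_pow_le hc₁ (n := n)
  rw [← hm] at h1 h3 h4 h5 h6 hcon
  have hLl : ⌈c₁ * n * Real.log n ^ 2⌉₊ ≤ l := Nat.ceil_le.2 hl
  have hE := lintegral_kaczmarzError hX hind hlaw m w hLl
  have hn0 : (0 : ℝ) < n := by positivity
  have hn2 : (n : ℝ) ^ (-2 : ℝ) * n ^ 2 = 1 := by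
    rw [← Real.rpow_natCast, ← Real.rpow_add hn0]
    simp
  have hnn : 0 < (n : ℝ) ^ (-2 : ℝ) := by positivity
  set L := ⌈c₁ * n * Real.log n ^ 2⌉₊
  set s := Real.log n
  have hm0 : (0 : ℝ) < 2 ^ m := by positivity
  -- For small `n` the bad event is null: the error never exceeds its initial size, and 6050 = 2·55²
  -- puts the threshold above it because 3025 n⁻² ≥ 1 and 2 log n ≥ 1.
  rcases lt_or_ge n 55 with h55 | h55
  · have hz : P.real {ω | 6050 * B * ((n : ℝ) ^ (-2 : ℝ) * s ^ 3) < ((2 : ℝ) ^ m)⁻¹ *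
        (kaczmarzError m (fun i => X i ω) w L ⬝ᵥ kaczmarzError m (fun i => X i ω) w L)} = 0 := by
      rw [measureReal_eq_zero_iff, measure_eq_zero_iff_ae_notMem]
      filter_upwards [hsq] with ω hω
      simp only [not_lt]
      have h7 := kaczmarzError_dotProduct_self_le hω w L
      refine (mul_le_mul_of_nonneg_left h7 (by positivity)).trans (hw.trans ?_)
      have h8 : (n : ℝ) ≤ 55 := by exact_mod_cast h55.le
      have h9 : 1 ≤ 3025 * (n : ℝ) ^ (-2 : ℝ) := by
        rw [← hn2, mul_comm 3025]
        exact mul_le_mul_of_nonneg_left (by nlinarith) hnn.le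
      calc B * s ^ 2 ≤ (3025 * (n : ℝ) ^ (-2 : ℝ)) * (2 * s) * (B * s ^ 2) :=
            le_mul_of_one_le_left (by positivity)
              (one_le_mul_of_one_le_of_one_le h9 (by linarith))
        _ = _ := by ring
    rw [hz]
    positivity
  · have hcon := hcon h55
    have hs4 := log_ge_four h55
    set T := 6050 * B * ((n : ℝ) ^ (-2 : ℝ) * s ^ 3) with hT
    have hT0 : 0 < T := by positivity
    set F : Ω → ℝ := fun ω =>
      kaczmarzError m (fun i => X i ω) w L ⬝ᵥ kaczmarzError m (fun i => X i ω) w L with hF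
    have hFm : Measurable fun ω => ENNReal.ofReal (F ω) :=
      ENNReal.measurable_ofReal.comp ((measurable_dotProduct_self _).comp
        ((measurable_kaczmarzError m l w L).comp (measurable_pi_lambda _ hX)))
    have hq := inv_two_pow_div_le_one m
    set q := ((2 : ℝ) ^ m)⁻¹ / (1 + (m : ℝ) / 2)
    have hmark : P {ω | T < ((2 : ℝ) ^ m)⁻¹ * F ω} ≤
        ENNReal.ofReal ((n : ℝ) ^ (-c₁) * (w ⬝ᵥ w) / (2 ^ m * T)) := by
      calc P {ω | T < ((2 : ℝ) ^ m)⁻¹ * F ω}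
          ≤ P {ω | ENNReal.ofReal (2 ^ m * T) ≤ ENNReal.ofReal (F ω)} := by
            refine measure_mono fun ω hω => ?_
            simp only [Set.mem_ofPred_eq] at hω ⊢
            rw [inv_mul_eq_div, lt_div_iff₀ hm0] at hω
            exact ENNReal.ofReal_le_ofReal (by linarith)
        _ ≤ (∫⁻ ω, ENNReal.ofReal (F ω) ∂P) / ENNReal.ofReal (2 ^ m * T) :=
            meas_ge_le_lintegral_div hFm.aemeasurable
              (by rw [ne_eq, ENNReal.ofReal_eq_zero, not_le]; positivity) ENNReal.ofReal_ne_top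
        _ ≤ _ := by
            rw [hE, ENNReal.ofReal_div_of_pos (by positivity),
              ENNReal.ofReal_mul (p := (n : ℝ) ^ (-c₁)) (by positivity),
              ← ENNReal.ofReal_pow (by linarith)]
            gcongr
    have hfin : (n : ℝ) ^ (-c₁) * (w ⬝ᵥ w) / (2 ^ m * T) ≤ (n : ℝ) ^ (2 - c₁) / 2 := by
      have hn3 : (n : ℝ) ^ (2 - c₁) = (n : ℝ) ^ (-c₁) * n ^ 2 := by
        rw [← Real.rpow_natCast, ← Real.rpow_add hn0]
        congr 1
        push_cast
        ring
      have hw' : w ⬝ᵥ w ≤ B * s ^ 2 * 2 ^ m := by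
        rwa [inv_mul_eq_div, div_le_iff₀ hm0] at hw
      rw [div_le_div_iff₀ (by positivity) two_pos, hn3]
      calc (n : ℝ) ^ (-c₁) * (w ⬝ᵥ w) * 2 ≤ (n : ℝ) ^ (-c₁) * (B * s ^ 2 * 2 ^ m) * 2 := by gcongr
        _ ≤ (n : ℝ) ^ (-c₁) * (B * s ^ 2 * 2 ^ m) * (6050 * s) := by
            gcongr
            linarith
        _ = (n : ℝ) ^ (-c₁) * (B * s ^ 2 * 2 ^ m) * (6050 * s) * ((n : ℝ) ^ (-2 : ℝ) * n ^ 2) := by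
            rw [hn2, mul_one]
        _ = _ := by rw [hT]; ring
    exact ENNReal.toReal_le_of_le_ofReal (by positivity)
      (hmark.trans (ENNReal.ofReal_le_ofReal hfin))

theorem two_mul_inv_two_pow_rpow_le {α : ℝ} (hα : 0 < α) (hα1 : α ≤ 1) {n : ℕ} (hn : 2 ≤ n) :
    (2 * ((2 : ℝ) ^ Nat.log 2 n)⁻¹) ^ α ≤ 4 * (n : ℝ) ^ (-α) := by
  obtain ⟨-, -, -, -, -, h6⟩ := log_bounds hn
  have hn0 : (0 : ℝ) < n := by positivity
  have h1 : 2 * ((2 : ℝ) ^ Nat.log 2 n)⁻¹ ≤ 4 * (n : ℝ)⁻¹ := by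
    rw [← div_eq_mul_inv, ← div_eq_mul_inv, div_le_div_iff₀ (by positivity) hn0]
    linarith
  calc _ ≤ (4 * (n : ℝ)⁻¹) ^ α := Real.rpow_le_rpow (by positivity) h1 hα.le
    _ = 4 ^ α * (n : ℝ) ^ (-α) := by
      rw [Real.mul_rpow (by norm_num) (by positivity), Real.rpow_neg hn0.le, Real.inv_rpow hn0.le]
    _ ≤ 4 ^ (1 : ℝ) * (n : ℝ) ^ (-α) := by
      gcongr
      norm_num
    _ = _ := by rw [Real.rpow_one]

theorem two_mul_inv_two_pow_rpow_le_one {α : ℝ} (hα : 0 < α) {n : ℕ} (hn : 2 ≤ n) :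
    (2 * ((2 : ℝ) ^ Nat.log 2 n)⁻¹) ^ α ≤ 1 := by
  obtain ⟨h1, -⟩ := log_bounds hn
  refine Real.rpow_le_one (by positivity) ?_ hα.le
  rw [← div_eq_mul_inv, div_le_one (by positivity)]
  exact le_self_pow₀ (by norm_num) (by omega)

/-- The constant in the error bound. -/
def errorConst (c c₁ : ℝ) : ℝ :=
  48 * c + √(3 * (6050 * (100 * c ^ 2) + 4 * c ^ 2 * (6050 * 4) + 192 * c ^ 2 * (2 * c₁ + 4)))

theorem error_le_errorConst_mul {c c₁ α : ℝ} (hc : 0 < c) (hc₁ : 0 < c₁) (hα : 0 < α)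
    (hα1 : α ≤ 1) {n m : ℕ} (hm : m = Nat.log 2 n) (hn : 2 ≤ n) {ε t a b : ℝ}
    (hε : ε = (m + 2) * (c * (2 * ((2 : ℝ) ^ m)⁻¹) ^ α)) (ht : |t| ≤ 2 * c)
    (ha : ((2 : ℝ) ^ m)⁻¹ * a ≤
      6050 * (100 * c ^ 2) * ((n : ℝ) ^ (-2 : ℝ) * Real.log n ^ 3))
    (hb : ((2 : ℝ) ^ m)⁻¹ * b ≤ 6050 * 4 * ((n : ℝ) ^ (-2 : ℝ) * Real.log n ^ 3)) :
    ε + √(((2 : ℝ) ^ m)⁻¹ * (3 * (a + t ^ 2 * b +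
        (⌈c₁ * n * Real.log n ^ 2⌉₊ : ℝ) * (ε ^ 2 / (1 + (m : ℝ) / 2))))) ≤
      errorConst c c₁ * ((n : ℝ) ^ (-α) * Real.log n ^ (3 / 2 : ℝ)) := by
  obtain ⟨h1, h2, h3, h4, h5, h6⟩ := log_bounds hn
  have hpow := two_mul_inv_two_pow_rpow_le hα hα1 hn
  have hL := (Nat.ceil_lt_add_one (a := c₁ * n * Real.log n ^ 2) (by positivity)).le
  rw [← hm] at h1 h3 h4 h5 h6 hpow
  set L : ℝ := (⌈c₁ * n * Real.log n ^ 2⌉₊ : ℝ)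
  set s := Real.log n
  set N := (n : ℝ) ^ (-α) with hN
  have hs0 : 0 < s := by linarith
  have hn0 : (0 : ℝ) < n := by positivity
  have hn2 : (2 : ℝ) ≤ n := by exact_mod_cast hn
  have hN0 : 0 < N := by positivity
  have hm0 : (0 : ℝ) < 2 ^ m := by positivity
  have hm1 : (0 : ℝ) ≤ m := by positivity
  have hs32 : (s ^ (3 / 2 : ℝ)) ^ 2 = s ^ 3 := by
    rw [← Real.rpow_natCast, ← Real.rpow_mul hs0.le, ← Real.rpow_natCast]
    norm_num
  have hss : s ≤ 2 * s ^ (3 / 2 : ℝ) := by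
    refine le_of_sq_le_sq ?_ (by positivity)
    rw [mul_pow, hs32]
    nlinarith [sq_nonneg s]
  -- Here α ≤ 1 is essential: the Markov threshold decays only like n⁻².
  have hnN : (n : ℝ) ^ (-2 : ℝ) ≤ N ^ 2 := by
    rw [hN, ← Real.rpow_natCast, ← Real.rpow_mul hn0.le]
    exact Real.rpow_le_rpow_of_exponent_le (by linarith) (by push_cast; linarith)
  have hε0 : 0 ≤ ε := by rw [hε]; positivity
  have hε1 : ε ≤ (m + 2) * (c * (4 * N)) := by rw [hε]; gcongr
  have hε2 : ε ≤ 48 * c * (N * s ^ (3 / 2 : ℝ)) := by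
    calc ε ≤ 6 * s * (c * (4 * N)) := hε1.trans (by gcongr)
      _ ≤ 6 * (2 * s ^ (3 / 2 : ℝ)) * (c * (4 * N)) := by gcongr
      _ = _ := by ring
  have hr : ε ^ 2 / (1 + (m : ℝ) / 2) ≤ 192 * c ^ 2 * s * N ^ 2 := by
    rw [div_le_iff₀ (by positivity)]
    calc ε ^ 2 ≤ ((m + 2) * (c * (4 * N))) ^ 2 := by gcongr
      _ = 32 * (m + 2) * (c ^ 2 * N ^ 2 * (1 + (m : ℝ) / 2)) := by ring
      _ ≤ 32 * (6 * s) * (c ^ 2 * N ^ 2 * (1 + (m : ℝ) / 2)) := by gcongr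
      _ = _ := by ring
  -- The 2c₁ comes from n ≤ 2·2ᵐ; the 4 absorbs the rounding of the step count, as 1 ≤ 4 log² n.
  have hLm : ((2 : ℝ) ^ m)⁻¹ * L ≤ (2 * c₁ + 4) * s ^ 2 := by
    rw [inv_mul_eq_div, div_le_iff₀ hm0]
    have e1 : c₁ * n * s ^ 2 ≤ c₁ * (2 * 2 ^ m) * s ^ 2 := by gcongr
    have e2 : 1 ≤ 4 * s ^ 2 * 2 ^ m := by
      have : (1 : ℝ) ≤ 2 ^ m := one_le_pow₀ (by norm_num)
      nlinarith
    nlinarith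
  have hres : ((2 : ℝ) ^ m)⁻¹ * (L * (ε ^ 2 / (1 + (m : ℝ) / 2))) ≤
      192 * c ^ 2 * (2 * c₁ + 4) * (N ^ 2 * s ^ 3) := by
    rw [← mul_assoc]
    calc _ ≤ (2 * c₁ + 4) * s ^ 2 * (192 * c ^ 2 * s * N ^ 2) := by gcongr
      _ = _ := by ring
  have ht2 : t ^ 2 ≤ 4 * c ^ 2 := by
    have := sq_le_sq' (abs_le.1 ht).1 (abs_le.1 ht).2
    linarith
  have hb' : ((2 : ℝ) ^ m)⁻¹ * (t ^ 2 * b) ≤ 4 * c ^ 2 * (6050 * 4) * (N ^ 2 * s ^ 3) := by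
    calc _ = t ^ 2 * (((2 : ℝ) ^ m)⁻¹ * b) := by ring
      _ ≤ t ^ 2 * (6050 * 4 * ((n : ℝ) ^ (-2 : ℝ) * s ^ 3)) := by gcongr
      _ ≤ 4 * c ^ 2 * (6050 * 4 * (N ^ 2 * s ^ 3)) := by gcongr
      _ = _ := by ring
  have ha' : ((2 : ℝ) ^ m)⁻¹ * a ≤ 6050 * (100 * c ^ 2) * (N ^ 2 * s ^ 3) :=
    ha.trans (by gcongr)
  rw [errorConst, add_mul]
  refine add_le_add hε2 (Real.sqrt_le_iff.2 ⟨by positivity, ?_⟩)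
  rw [mul_pow, Real.sq_sqrt (by positivity), mul_pow, hs32]
  linarith

theorem kaczmarzApprox_of_const {c₁ : ℝ} {n l : ℕ} (hl : 0 < l) (x : Fin l → I × I) {f : I × I → ℝ}
    (hf : ∀ p q, f p = f q) : kaczmarzApprox c₁ n x (fun i => f (x i)) = f := by
  ext p
  have h : (fun k => f (x k) - firstValue fun i => f (x i)) = fun _ => 0 := by
    ext k
    simp [firstValue, hl, hf (x k) (x ⟨0, hl⟩)]
  rw [kaczmarzApprox, h, kaczmarz_zero]
  simp [firstValue, hl, hf (x ⟨0, hl⟩) p]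

end

/-! ### Assembly of the main theorem. -/

theorem theorem1 (c c₁ : ℝ) (hc : 0 < c) (hc₁ : 0 < c₁) :
    ∃ C : ℝ, 0 < C ∧
      ∀ (α : ℝ), 0 < α →
      ∀ (f : I × I → ℝ), IsMixedHolder c α f →
      ∀ (n l : ℕ), 1 ≤ n → c₁ * n * Real.log n ^ 2 ≤ l →
      ∀ (Ω : Type*) [MeasurableSpace Ω] (P : Measure Ω) [IsProbabilityMeasure P]
        (X : Fin l → Ω → I × I),
        (∀ i, Measurable (X i)) → iIndepFun X P →
        (∀ i, P.map (X i) = (volume : Measure (I × I))) →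
        1 - (n : ℝ) ^ (2 - c₁) ≤
          P.real {ω | eLpNorm
              (f - kaczmarzApprox c₁ n (fun i => X i ω) (fun i => f (X i ω))) 2 volume
            ≤ ENNReal.ofReal (C * ((n : ℝ) ^ (-α) * Real.log n ^ (3 / 2 : ℝ)))} := by
  refine ⟨errorConst c c₁, by rw [errorConst]; positivity, ?_⟩
  intro α hα f hf n l hn1 hl Ω _ P _ X hX hind hlaw
  rcases hn1.eq_or_lt with rfl | hn
  · simp
  have hn : 2 ≤ n := hn
  obtain ⟨m, hm⟩ : ∃ m, m = Nat.log 2 n := ⟨_, rfl⟩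
  obtain ⟨h1, h2, h3, h4, h5, h6⟩ := log_bounds hn
  have hone := two_mul_inv_two_pow_rpow_le_one hα hn
  rw [← hm] at h1 h3 h4 h5 h6 hone
  have hl0 : 0 < l := by
    have : 0 < c₁ * n * Real.log n ^ 2 := by positivity
    exact_mod_cast this.trans_le hl
  rcases lt_or_ge 1 α with hα1 | hα1
  · simp only [kaczmarzApprox_of_const hl0 _ (hf.eq_of_one_lt hα1), sub_self]
    simp
    positivity
  -- Centring at f(0, 0) instead of the first sample value keeps `z` deterministic, and keeps its
  -- size bounded by the oscillation of `f`.
  obtain ⟨z, hz⟩ := exists_abs_sub_embed_dotProduct_le hc hα hf m (f (0, 0))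
  set ε := (m + 2) * (c * (2 * ((2 : ℝ) ^ m)⁻¹) ^ α) with hε
  have hε0 : 0 ≤ ε := by positivity
  have hε1 : ε ≤ 6 * c * Real.log n := by
    calc ε ≤ 6 * Real.log n * (c * 1) := by rw [hε]; gcongr
      _ = _ := by ring
  have hsq : ∀ᵐ ω ∂P, ∀ i, X i ω ∈ openUnitSquare := by
    refine ae_all_iff.2 fun i => ?_
    refine ae_of_ae_map (hX i).aemeasurable ?_
    rw [hlaw i]
    exact ae_mem_openUnitSquare
  have hwz : ((2 : ℝ) ^ m)⁻¹ * (z ⬝ᵥ z) ≤ 100 * c ^ 2 * Real.log n ^ 2 := by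
    -- 10 = 6 + 4: ε is at most 6c log n, and the oscillation 2c is at most 4c log n because log n ≥
    -- 1/2.
    refine (inv_two_pow_mul_dotProduct_self_le (b := 10 * c * Real.log n) fun p hp => ?_).trans
      (by ring_nf; exact le_rfl)
    have e1 := abs_sub_abs_le_abs_sub (embed m p ⬝ᵥ z) (f p - f (0, 0))
    rw [abs_sub_comm (embed m p ⬝ᵥ z)] at e1
    have e2 := hf.abs_sub_le hc hα p (0, 0)
    have e3 := hz p hp
    have e4 : c * (1 / 2) ≤ c * Real.log n := mul_le_mul_of_nonneg_left h2 hc.le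
    linarith
  have hwu : ((2 : ℝ) ^ m)⁻¹ * (constVec m ⬝ᵥ constVec m) ≤ 4 * Real.log n ^ 2 := by
    refine (inv_two_pow_mul_dotProduct_self_le (b := 1) fun p hp => ?_).trans (by nlinarith)
    rw [embed_dotProduct_constVec hp, abs_one]
  have hPz := measure_kaczmarzError_gt_le hc₁ hm hn hl hX hind hlaw hsq
    (by positivity) hwz
  have hPu := measure_kaczmarzError_gt_le hc₁ hm hn hl hX hind hlaw hsq
    (by positivity) hwu
  set Bz := {ω | 6050 * (100 * c ^ 2) * ((n : ℝ) ^ (-2 : ℝ) * Real.log n ^ 3) < ((2 : ℝ) ^ m)⁻¹ *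
    (kaczmarzError m (fun i => X i ω) z ⌈c₁ * n * Real.log n ^ 2⌉₊ ⬝ᵥ
      kaczmarzError m (fun i => X i ω) z ⌈c₁ * n * Real.log n ^ 2⌉₊)} with hBz
  set Bu := {ω | 6050 * 4 * ((n : ℝ) ^ (-2 : ℝ) * Real.log n ^ 3) < ((2 : ℝ) ^ m)⁻¹ *
    (kaczmarzError m (fun i => X i ω) (constVec m) ⌈c₁ * n * Real.log n ^ 2⌉₊ ⬝ᵥ
      kaczmarzError m (fun i => X i ω) (constVec m) ⌈c₁ * n * Real.log n ^ 2⌉₊)} with hBu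
  set T := {ω | eLpNorm
      (f - kaczmarzApprox c₁ n (fun i => X i ω) (fun i => f (X i ω))) 2 volume
      ≤ ENNReal.ofReal (errorConst c c₁ * ((n : ℝ) ^ (-α) * Real.log n ^ (3 / 2 : ℝ)))} with hT
  -- Covering almost all of Ω and using subadditivity avoids any measurability of the good event
  -- `T`.
  have hcover : ∀ᵐ ω ∂P, ω ∈ T ∪ (Bz ∪ Bu) := by
    filter_upwards [hsq] with ω hω
    by_cases hz' : ω ∈ Bz
    · exact Or.inr (Or.inl hz')
    by_cases hu' : ω ∈ Bu
    · exact Or.inr (Or.inr hu')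
    refine Or.inl ?_
    rw [hBz, Set.mem_ofPred_eq, not_lt] at hz'
    rw [hBu, Set.mem_ofPred_eq, not_lt] at hu'
    refine (eLpNorm_sub_kaczmarzApprox_le (c₁ := c₁) hm hl0 hω hε0 hz).trans
      (ENNReal.ofReal_le_ofReal ?_)
    exact error_le_errorConst_mul hc hc₁ hα hα1 hm hn hε (hf.abs_sub_le hc hα _ _) hz' hu'
  have hprob : 1 ≤ P.real T + (P.real Bz + P.real Bu) := by
    have h7 : P.real (T ∪ (Bz ∪ Bu)) = 1 := by
      have hu : (T ∪ (Bz ∪ Bu) : Set Ω) =ᵐ[P] Set.univ := Filter.eventuallyEq_univ.2 hcover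
      rw [measureReal_congr hu, probReal_univ]
    rw [← h7]
    exact (measureReal_union_le _ _).trans (add_le_add le_rfl (measureReal_union_le _ _))
  linarith
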